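/- Let $(M,g)$ be an $n$-dimensional smooth Riemannian manifold (not assumed complete) with Riemann curvature tensor $R$, with the sign convention that $R(u,v,u,v)$ is the sectional curvature of the plane spanned by orthonormal $u,v$. The curvature operator of the second kind at $p\in M$ is the symmetric bilinear form $$\mathring R(\varphi,\psi)=\sum_{i,j,k,l}R_{ijkl}\,\varphi_{il}\,\psi_{jk}$$ on the space $S^2_0(T_pM)$ of traceless symmetric two-tensors, components being taken in an orthonormal basis of $T_pM$. For $1\le\alpha\le N:=\frac{(n-1)(n+2)}2=\dim S^2_0(T_pM)$ it is called $\alpha$-nonnegative (respectively $\alpha$-nonpositive) if for every $p\in M$ and every orthonormal basis $\varphi_1,\dots,\varphi_N$ of $S^2_0(T_pM)$ $$\sum_{i=1}^{\lfloor\alpha\rfloor}\mathring R(\varphi_i,\varphi_i)+(\alpha-\lfloor\alpha\rfloor)\,\mathring R(\varphi_{\lfloor\alpha\rfloor+1},\varphi_{\lfloor\alpha\rfloor+1})\ \ge 0\quad(\text{respectively}\ \le 0),$$ where the last term is omitted if $\alpha=N$. For an integer $1\le k\le n/2$, say that $M$ locally splits off a $k$-dimensional factor near $q\in M$ if some open neighbourhood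 of $q$ is isometric to a Riemannian product $(M_1\times M_2,g_1\oplus g_2)$ of Riemannian manifolds of dimensions $k$ and $n-k$. **Theorem.** Let $1\le k\le n/2$, and suppose that $(M,g)$ has $\alpha$-nonnegative or $\alpha$-nonpositive curvature operator of the second kind for some $$1\le\alpha<k(n-k)+\frac{2k(n-k)}{n}.$$ If $M$ locally splits off a $k$-dimensional factor near a point $q\in M$, then $M$ is flat in a neighbourhood of $q$ (that is, $R=0$ there). In particular, if $M$ locally splits off a $k$-dimensional factor near every point of $M$, then $M$ is flat. -/

import Mathlib

open scoped Manifold ContDiff Topology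

universe u v w

noncomputable section

/-! ### Curvature of a metric on an open subset of Euclidean space

A metric is given by `G : E → E → E → ℝ`, where `G x u v` is the inner product at `x` of the vectors
`u` and `v` (it is smooth in `x` near the points of interest, bilinear in `u`, `v`). -/

/-- The Gram matrix `(g_ij)` of a metric at `x` in the standard basis. -/
def gramMatrix {n : ℕ}
    (G : EuclideanSpace ℝ (Fin n) → EuclideanSpace ℝ (Fin n) → EuclideanSpace ℝ (Fin n) → ℝ)
    (x : EuclideanSpace ℝ (Fin n)) : Matrix (Fin n) (Fin n) ℝ :=
  Matrix.of fun i j => G x (EuclideanSpace.single i 1) (EuclideanSpace.single j 1)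

/-- Christoffel symbols of the first kind: `½ (∂_u g(v,w) + ∂_v g(u,w) - ∂_w g(u,v))` at `x`, for
constant vector fields `u`, `v`, `w`. -/
def christoffelFirst {n : ℕ}
    (G : EuclideanSpace ℝ (Fin n) → EuclideanSpace ℝ (Fin n) → EuclideanSpace ℝ (Fin n) → ℝ)
    (x u v w : EuclideanSpace ℝ (Fin n)) : ℝ :=
  (1 / 2) * (fderiv ℝ (fun y => G y v w) x u + fderiv ℝ (fun y => G y u w) x v
    - fderiv ℝ (fun y => G y u v) x w)

/-- Christoffel symbols of the second kind: the vector `Γ(u,v) = ∇_u v` at `x`, for constant vector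
fields `u`, `v`, where `∇` is the Levi-Civita connection; `Γ(u,v)^k = ∑_l g^{kl} [uv, l]`. -/
def christoffel {n : ℕ}
    (G : EuclideanSpace ℝ (Fin n) → EuclideanSpace ℝ (Fin n) → EuclideanSpace ℝ (Fin n) → ℝ)
    (x u v : EuclideanSpace ℝ (Fin n)) : EuclideanSpace ℝ (Fin n) :=
  ∑ k, (∑ l, (gramMatrix G x)⁻¹ k l * christoffelFirst G x u v (EuclideanSpace.single l 1)) •
    EuclideanSpace.single k (1 : ℝ)

/-- The curvature `R(u,v)w = ∇_u ∇_v w - ∇_v ∇_u w` at `x`, for constant vector fields `u`, `v`, `w`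
(whose brackets vanish): `∂_u Γ(v,w) - ∂_v Γ(u,w) + Γ(u,Γ(v,w)) - Γ(v,Γ(u,w))`. -/
def coordCurvature {n : ℕ}
    (G : EuclideanSpace ℝ (Fin n) → EuclideanSpace ℝ (Fin n) → EuclideanSpace ℝ (Fin n) → ℝ)
    (x u v w : EuclideanSpace ℝ (Fin n)) : EuclideanSpace ℝ (Fin n) :=
  fderiv ℝ (fun y => christoffel G y v w) x u - fderiv ℝ (fun y => christoffel G y u w) x v
    + christoffel G x u (christoffel G x v w) - christoffel G x v (christoffel G x u w)

/-! ### Riemannian manifolds and their curvature tensor -/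

/-- A smooth Riemannian metric on the smooth `n`-manifold `M`. -/
abbrev SmoothMetric (n : ℕ) (M : Type*) [TopologicalSpace M]
    [ChartedSpace (EuclideanSpace ℝ (Fin n)) M] [IsManifold (𝓡 n) ∞ M] :=
  Bundle.ContMDiffRiemannianMetric (𝓡 n) ∞ (EuclideanSpace ℝ (Fin n))
    (fun x : M => TangentSpace (𝓡 n) x)

section Riemannian

variable {n : ℕ} {M : Type*} [TopologicalSpace M] [ChartedSpace (EuclideanSpace ℝ (Fin n)) M]
  [IsManifold (𝓡 n) ∞ M]

/-- The metric `g` in the preferred chart around `p`: the pullback of `g` by the inverse chart. -/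
def metricInChart (g : SmoothMetric n M) (p : M) (x u v : EuclideanSpace ℝ (Fin n)) : ℝ :=
  g.inner ((extChartAt (𝓡 n) p).symm x)
    (mfderiv 𝓘(ℝ, EuclideanSpace ℝ (Fin n)) (𝓡 n) (extChartAt (𝓡 n) p).symm x u)
    (mfderiv 𝓘(ℝ, EuclideanSpace ℝ (Fin n)) (𝓡 n) (extChartAt (𝓡 n) p).symm x v)

/-- The coordinate vector of a tangent vector at `p`, in the preferred chart around `p`. -/
def toCoord (p : M) (u : TangentSpace (𝓡 n) p) : EuclideanSpace ℝ (Fin n) :=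
  mfderiv (𝓡 n) 𝓘(ℝ, EuclideanSpace ℝ (Fin n)) (extChartAt (𝓡 n) p) p u

/-- The Riemann curvature tensor `R(u,v,w,z) = g(R(u,v)z, w)` at `p`, computed in the preferred chart
around `p`. With this sign convention `R(u,v,u,v)` is the sectional curvature of the plane spanned by
orthonormal `u`, `v`. -/
def riemannTensor (g : SmoothMetric n M) (p : M) (u v w z : TangentSpace (𝓡 n) p) : ℝ :=
  metricInChart g p (extChartAt (𝓡 n) p p)
    (coordCurvature (metricInChart g p) (extChartAt (𝓡 n) p p)
      (toCoord p u) (toCoord p v) (toCoord p z))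
    (toCoord p w)

/-- The curvature tensor vanishes at `p`. -/
def IsFlatAt (g : SmoothMetric n M) (p : M) : Prop :=
  ∀ u v w z : TangentSpace (𝓡 n) p, riemannTensor g p u v w z = 0

/-- `(M, g)` is flat: its curvature tensor vanishes identically. -/
def IsFlat (g : SmoothMetric n M) : Prop :=
  ∀ p : M, IsFlatAt g p

/-- `e` is an orthonormal basis of `(T_pM, g_p)`. -/
def IsOrthonormalFrame (g : SmoothMetric n M) (p : M) (e : Fin n → TangentSpace (𝓡 n) p) : Prop :=
  ∀ i j, g.inner p (e i) (e j) = if i = j then 1 else 0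

end Riemannian

/-! ### Two-tensors and the curvature operator of the second kind

`e` is an orthonormal basis of a Euclidean space `V`; none of the notions of this section depends on
the choice of it. -/

section TwoTensors

variable {n : ℕ} {V : Type*} [AddCommGroup V] [Module ℝ V]

/-- The space `S²₀(V)` of traceless symmetric two-tensors on `V`. -/
def tracelessSym (e : Fin n → V) : Submodule ℝ (LinearMap.BilinForm ℝ V) where
  carrier := {φ | (∀ u v, φ u v = φ v u) ∧ ∑ i, φ (e i) (e i) = 0}
  add_mem' := by
    rintro φ ψ ⟨h1, h2⟩ ⟨h3, h4⟩
    refine ⟨fun u v => ?_, ?_⟩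
    · simp [h1 u v, h3 u v]
    · simp [Finset.sum_add_distrib, h2, h4]
  zero_mem' := by simp
  smul_mem' := by
    rintro c φ ⟨h1, h2⟩
    refine ⟨fun u v => ?_, ?_⟩
    · simp [h1 u v]
    · simp [← Finset.mul_sum, h2]

/-- The inner product `⟨φ, ψ⟩ = ∑ φ_ij ψ_ij` of two-tensors on `V`. -/
def tensorInner (e : Fin n → V) (φ ψ : LinearMap.BilinForm ℝ V) : ℝ :=
  ∑ i, ∑ j, φ (e i) (e j) * ψ (e i) (e j)

/-- `φ` is an orthonormal basis of `S²₀(V)`. -/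
def IsOrthonormalBasisS20 {ι : Type*} [DecidableEq ι] (e : Fin n → V)
    (φ : ι → LinearMap.BilinForm ℝ V) : Prop :=
  (∀ i j, tensorInner e (φ i) (φ j) = if i = j then 1 else 0) ∧
    Submodule.span ℝ (Set.range φ) = tracelessSym e

/-- The curvature operator of the second kind `R̊(φ, ψ) = ∑ R_ijkl φ_il ψ_jk` of `R`, as a bilinear
form. -/
def secondKind (R : V → V → V → V → ℝ) (e : Fin n → V) (φ ψ : LinearMap.BilinForm ℝ V) : ℝ :=
  ∑ i, ∑ j, ∑ k, ∑ l, R (e i) (e j) (e k) (e l) * φ (e i) (e l) * ψ (e j) (e k)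

end TwoTensors

/-- For `a = (a_1, …, a_N)` and `0 ≤ α ≤ N`, the sum `a_1 + ⋯ + a_⌊α⌋ + (α - ⌊α⌋) a_{⌊α⌋+1}`. The
indices in `Fin N` start at `0`, and the last term is absent when `α = N`. -/
def fracSum {N : ℕ} (α : ℝ) (a : Fin N → ℝ) : ℝ :=
  ∑ i : Fin N,
    (if (i : ℕ) < ⌊α⌋₊ then 1 else if (i : ℕ) = ⌊α⌋₊ then α - (⌊α⌋₊ : ℝ) else 0) * a i

section Conditions

variable {n : ℕ} {M : Type*} [TopologicalSpace M] [ChartedSpace (EuclideanSpace ℝ (Fin n)) M]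
  [IsManifold (𝓡 n) ∞ M]

/-- `(M, g)` has `α`-nonnegative curvature operator of the second kind, for
`1 ≤ α ≤ (n-1)(n+2)/2 = dim S²₀(T_pM)`. -/
def AlphaNonneg (g : SmoothMetric n M) (α : ℝ) : Prop :=
  ∀ (p : M) (e : Fin n → TangentSpace (𝓡 n) p), IsOrthonormalFrame g p e →
    ∀ φ : Fin ((n - 1) * (n + 2) / 2) → LinearMap.BilinForm ℝ (TangentSpace (𝓡 n) p),
      IsOrthonormalBasisS20 e φ →
        0 ≤ fracSum α fun i => secondKind (riemannTensor g p) e (φ i) (φ i)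

/-- `(M, g)` has `α`-nonpositive curvature operator of the second kind, for
`1 ≤ α ≤ (n-1)(n+2)/2 = dim S²₀(T_pM)`. -/
def AlphaNonpos (g : SmoothMetric n M) (α : ℝ) : Prop :=
  ∀ (p : M) (e : Fin n → TangentSpace (𝓡 n) p), IsOrthonormalFrame g p e →
    ∀ φ : Fin ((n - 1) * (n + 2) / 2) → LinearMap.BilinForm ℝ (TangentSpace (𝓡 n) p),
      IsOrthonormalBasisS20 e φ →
        fracSum α (fun i => secondKind (riemannTensor g p) e (φ i) (φ i)) ≤ 0

end Conditions

/-! ### Local splittings -/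

/-- `Φ` is an isometry of the Riemannian product `(M₁ × M₂, g₁ ⊕ g₂)` onto an open subset of
`(M, g)`: an injective local diffeomorphism (hence a diffeomorphism onto an open subset) that pulls
`g` back to `pr₁^* g₁ + pr₂^* g₂`. -/
def IsOpenIsometryFromProduct {n k m : ℕ}
    {M : Type*} [TopologicalSpace M] [ChartedSpace (EuclideanSpace ℝ (Fin n)) M]
    [IsManifold (𝓡 n) ∞ M]
    {M₁ : Type*} [TopologicalSpace M₁] [ChartedSpace (EuclideanSpace ℝ (Fin k)) M₁]
    [IsManifold (𝓡 k) ∞ M₁]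
    {M₂ : Type*} [TopologicalSpace M₂] [ChartedSpace (EuclideanSpace ℝ (Fin m)) M₂]
    [IsManifold (𝓡 m) ∞ M₂]
    (g : SmoothMetric n M) (g₁ : SmoothMetric k M₁) (g₂ : SmoothMetric m M₂)
    (Φ : M₁ × M₂ → M) : Prop :=
  Function.Injective Φ ∧ IsLocalDiffeomorph ((𝓡 k).prod (𝓡 m)) (𝓡 n) ∞ Φ ∧
    ∀ (x : M₁ × M₂) (v w : TangentSpace ((𝓡 k).prod (𝓡 m)) x),
      g.inner (Φ x) (mfderiv ((𝓡 k).prod (𝓡 m)) (𝓡 n) Φ x v)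
          (mfderiv ((𝓡 k).prod (𝓡 m)) (𝓡 n) Φ x w) =
        g₁.inner x.1 (mfderiv ((𝓡 k).prod (𝓡 m)) (𝓡 k) Prod.fst x v)
            (mfderiv ((𝓡 k).prod (𝓡 m)) (𝓡 k) Prod.fst x w) +
          g₂.inner x.2 (mfderiv ((𝓡 k).prod (𝓡 m)) (𝓡 m) Prod.snd x v)
            (mfderiv ((𝓡 k).prod (𝓡 m)) (𝓡 m) Prod.snd x w)

/-- `(M, g)` locally splits off a `k`-dimensional factor near `q`: some open neighbourhood of `q` is
isometric to a Riemannian product of a `k`-dimensional and an `(n-k)`-dimensional Riemannian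
manifold. -/
def LocallySplitsOff {n : ℕ}
    {M : Type u} [TopologicalSpace M] [ChartedSpace (EuclideanSpace ℝ (Fin n)) M]
    [IsManifold (𝓡 n) ∞ M] (g : SmoothMetric n M) (k : ℕ) (q : M) : Prop :=
  ∃ (M₁ : Type v) (_ : TopologicalSpace M₁) (_ : ChartedSpace (EuclideanSpace ℝ (Fin k)) M₁)
    (_ : IsManifold (𝓡 k) ∞ M₁)
    (M₂ : Type w) (_ : TopologicalSpace M₂) (_ : ChartedSpace (EuclideanSpace ℝ (Fin (n - k))) M₂)
    (_ : IsManifold (𝓡 (n - k)) ∞ M₂)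
    (g₁ : SmoothMetric k M₁) (g₂ : SmoothMetric (n - k) M₂) (Φ : M₁ × M₂ → M),
    IsOpenIsometryFromProduct g g₁ g₂ Φ ∧ q ∈ Set.range Φ

end

noncomputable section

/-! ### Weighted sums -/

/-! At one point the hypothesis enters through a convexity remark: if every ordering of the values
of R̊ on an orthonormal basis passes the α-test, then every weighted sum of these values with
weights in [0,1] and total at least α is nonnegative (`weighted_sum_nonneg`). It therefore suffices
to find weights of total km + 2km/n, with m = n - k, whose weighted sum vanishes identically for
curvature tensors that split along W₁ ⊕ W₂.

In a frame adapted to the splitting, the km mixed tensors get weight 1 and contribute 0, since mixed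
sectional curvatures vanish. The traceless combination ζ of the metrics of the two factors also gets
weight 1 and contributes -(m/(nk)) scal₁ - (k/(nm)) scal₂. The trace of R̊ over the traceless
tensors of the factors is ((k+2)/(2k)) scal₁ and ((m+2)/(2m)) scal₂, so the weights c₁ = 2m/(n(k+2))
and c₂ = 2k/(n(m+2)) there cancel ζ exactly, and the total weight is the threshold. As c₁, c₂ lie
strictly between 0 and 1 and α is strictly below the threshold, the weight of a single tensor e_i ⊙
e_j inside a factor can be moved both up and down. This forces the sectional curvature of e_i, e_j
to be ≥ 0 and ≤ 0 (`sectional_eq_zero_of_adapted`). Every orthonormal pair in a factor extends to an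
adapted frame, so polarization and the Bianchi identity give R = 0 (`curvature_eq_zero_of_split`).
The nonpositive case is the same statement for -R.

The geometric half supplies the algebraic input. The coordinate formula for the curvature is that of
a Levi-Civita connection, hence has the usual symmetries (`isCurvatureLike_riemannTensor`). In
product coordinates the Koszul formula shows that covariant differentiation preserves the tangent
spaces of the factors, so R(u,v) does too (`exists_curvature_splitting`). -/

lemma sum_fracSum_weights {N : ℕ} {α : ℝ} (hα0 : 0 ≤ α) (hα : α < N) :
    ∑ i : Fin N, (if (i : ℕ) < ⌊α⌋₊ then (1 : ℝ) else
      if (i : ℕ) = ⌊α⌋₊ then α - (⌊α⌋₊ : ℝ) else 0) = α := by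
  have hm : ⌊α⌋₊ < N := (Nat.floor_lt hα0).2 hα
  rw [Fin.sum_univ_eq_sum_range (fun i : ℕ => if i < ⌊α⌋₊ then (1 : ℝ) else
      if i = ⌊α⌋₊ then α - (⌊α⌋₊ : ℝ) else 0) N]
  have h : ∀ i ∈ Finset.range N, (if i < ⌊α⌋₊ then (1 : ℝ) else
      if i = ⌊α⌋₊ then α - (⌊α⌋₊ : ℝ) else 0) =
      (if i < ⌊α⌋₊ then (1 : ℝ) else 0) + if i = ⌊α⌋₊ then α - (⌊α⌋₊ : ℝ) else 0 := by
    intro i _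
    split_ifs with h1 h2 <;> first | omega | simp
  rw [Finset.sum_congr rfl h, Finset.sum_add_distrib, Finset.sum_ite_eq' (Finset.range N),
    if_pos (Finset.mem_range.2 hm), ← Finset.sum_filter]
  have : (Finset.range N).filter (fun i => i < ⌊α⌋₊) = Finset.range ⌊α⌋₊ := by
    ext i; simp; omega
  rw [this]; simp

/-- If every rearrangement of `a` has nonnegative `fracSum α`, then every weighted sum of `a` with
weights in `[0, 1]` of total weight at least `α` is nonnegative. -/
lemma weighted_sum_nonneg {N : ℕ} {α : ℝ} (hα1 : 1 ≤ α) (hα : α < N) (a : Fin N → ℝ)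
    (h : ∀ σ : Equiv.Perm (Fin N), 0 ≤ fracSum α (a ∘ σ)) (w : Fin N → ℝ)
    (hw0 : ∀ i, 0 ≤ w i) (hw1 : ∀ i, w i ≤ 1) (hw : α ≤ ∑ i, w i) : 0 ≤ ∑ i, w i * a i := by
  have hα0 : 0 ≤ α := by linarith
  have hm : ⌊α⌋₊ < N := (Nat.floor_lt hα0).2 hα
  have hm1 : 1 ≤ ⌊α⌋₊ := (Nat.one_le_floor_iff α).2 hα1
  set σ := Tuple.sort a
  have hmono : Monotone (a ∘ σ) := Tuple.monotone_sort a
  set b := a ∘ σ with hb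
  set f : Fin N → ℝ := fun i => if (i : ℕ) < ⌊α⌋₊ then (1 : ℝ) else
      if (i : ℕ) = ⌊α⌋₊ then α - (⌊α⌋₊ : ℝ) else 0 with hf
  have hfs : ∑ i, f i = α := sum_fracSum_weights hα0 hα
  have hfb : 0 ≤ ∑ i, f i * b i := h σ
  have hf0 : ∀ i, 0 ≤ f i := by
    intro i
    simp only [hf]
    split_ifs
    · norm_num
    · linarith [Nat.floor_le hα0]
    · norm_num
  -- The sorted value at which the fractional weight sits separates the entries of full weight from
  -- those of weight zero. It is nonnegative, since otherwise the α-sum would be at most α * t < 0.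
  set t := b ⟨⌊α⌋₊, hm⟩ with ht
  have ht0 : 0 ≤ t := by
    by_contra hneg
    push Not at hneg
    have h1 : ∑ i, f i * b i ≤ ∑ i, f i * t := by
      refine Finset.sum_le_sum fun i _ => ?_
      by_cases hi : (i : ℕ) ≤ ⌊α⌋₊
      · exact mul_le_mul_of_nonneg_left (hmono (by exact hi)) (hf0 i)
      · have : f i = 0 := by
          simp only [hf]; rw [if_neg (by omega), if_neg (by omega)]
        simp [this]
    rw [← Finset.sum_mul, hfs] at h1
    nlinarith
  have hwσ : ∑ i, w (σ i) = ∑ i, w i := Equiv.sum_comp σ w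
  have hwa : ∑ i, w (σ i) * b i = ∑ i, w i * a i := Equiv.sum_comp σ fun i => w i * a i
  -- Exchange argument: `w - f` is ≤ 0 where `b ≤ t` and ≥ 0 where `b ≥ t`, so each product (w -
  -- f)(b - t) is nonnegative.
  have key : ∑ i, (w (σ i) - f i) * t ≤ ∑ i, (w (σ i) - f i) * b i := by
    refine Finset.sum_le_sum fun i _ => ?_
    rcases lt_trichotomy (i : ℕ) ⌊α⌋₊ with hi | hi | hi
    · have h1 : f i = 1 := by simp only [hf]; rw [if_pos hi]
      have h2 : b i ≤ t := hmono (by exact hi.le)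
      nlinarith [hw1 (σ i)]
    · have : i = ⟨⌊α⌋₊, hm⟩ := Fin.ext hi
      rw [this]
    · have h1 : f i = 0 := by
        simp only [hf]; rw [if_neg (by omega), if_neg (by omega)]
      have h2 : t ≤ b i := hmono (by exact hi.le)
      nlinarith [hw0 (σ i)]
  rw [← Finset.sum_mul, Finset.sum_sub_distrib, hfs, hwσ] at key
  simp only [sub_mul, Finset.sum_sub_distrib] at key
  rw [hwa] at key
  nlinarith

/-! ### Finite sums -/

lemma sum_subtype_ne {ι : Type*} [Fintype ι] [DecidableEq ι] (z : ι) (f : ι → ℝ) :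
    ∑ a : {a : ι // a ≠ z}, f a = ∑ a, f a - f z := by
  rw [← Finset.sum_erase_eq_sub (Finset.mem_univ z)]
  exact (Finset.sum_subtype _ (by simp) f).symm

lemma sum_subtype_lt {n : ℕ} (f : Fin n → Fin n → ℝ) :
    ∑ p : {p : Fin n × Fin n // p.1 < p.2}, f p.1.1 p.1.2 =
      ∑ i, ∑ j, if i < j then f i j else 0 := by
  rw [← Fintype.sum_prod_type' (fun i j => if i < j then f i j else 0), ← Finset.sum_filter]
  exact (Finset.sum_subtype (p := fun p : Fin n × Fin n => p.1 < p.2) _ (by simp)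
    (fun p : Fin n × Fin n => f p.1 p.2)).symm

lemma two_mul_sum_lt {n : ℕ} (f : Fin n → Fin n → ℝ) (hf : ∀ i j, f i j = f j i) :
    2 * ∑ p : {p : Fin n × Fin n // p.1 < p.2}, f p.1.1 p.1.2 =
      ∑ i, ∑ j, f i j - ∑ i, f i i := by
  rw [sum_subtype_lt]
  have h1 : ∑ i, ∑ j, (if i < j then f i j else 0) = ∑ i, ∑ j, if j < i then f i j else 0 := by
    rw [Finset.sum_comm]
    exact Finset.sum_congr rfl fun i _ => Finset.sum_congr rfl fun j _ => by rw [hf j i]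
  have h2 : ∑ i, f i i = ∑ i, ∑ j, if i = j then f i j else 0 := by simp
  rw [two_mul]
  nth_rewrite 2 [h1]
  rw [h2, ← Finset.sum_add_distrib, ← Finset.sum_sub_distrib]
  refine Finset.sum_congr rfl fun i _ => ?_
  rw [← Finset.sum_add_distrib, ← Finset.sum_sub_distrib]
  refine Finset.sum_congr rfl fun j _ => ?_
  rcases lt_trichotomy i j with h | h | h
  · simp [h, h.not_gt, h.ne]
  · simp [h]
  · simp [h, h.not_gt, h.ne']

lemma card_subtype_lt (n : ℕ) :
    Fintype.card {p : Fin n × Fin n // p.1 < p.2} = n * (n - 1) / 2 := by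
  have h := two_mul_sum_lt (n := n) (fun _ _ => 1) (fun _ _ => rfl)
  simp only [Finset.sum_const, Finset.card_univ, Fintype.card_fin, nsmul_eq_mul, mul_one] at h
  have h2 : 2 * Fintype.card {p : Fin n × Fin n // p.1 < p.2} + n = n * n := by
    have : (2 : ℝ) * Fintype.card {p : Fin n × Fin n // p.1 < p.2} + n = n * n := by linarith
    exact_mod_cast this
  have h3 : n * (n - 1) = 2 * Fintype.card {p : Fin n × Fin n // p.1 < p.2} := by
    rw [Nat.mul_sub, mul_one]; omega
  omega

/-! ### An orthonormal basis of the traceless symmetric tensors -/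

section Basis

variable {n : ℕ} {V : Type*} [AddCommGroup V] [Module ℝ V]

/-- The unit tensor `(e_i ⊗ e_j + e_j ⊗ e_i) / √2`. -/
def offForm (b : Module.Basis (Fin n) ℝ V) (i j : Fin n) : LinearMap.BilinForm ℝ V :=
  Matrix.toBilin b (Matrix.of fun p q =>
    (√2)⁻¹ * ((if p = i then 1 else 0) * (if q = j then 1 else 0)
      + (if p = j then 1 else 0) * (if q = i then 1 else 0)))

/-- The diagonal tensor `∑ d_i e_i ⊗ e_i`. -/
def diagForm (b : Module.Basis (Fin n) ℝ V) (d : Fin n → ℝ) : LinearMap.BilinForm ℝ V :=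
  Matrix.toBilin b (Matrix.diagonal d)

lemma toBilin_apply_basis (b : Module.Basis (Fin n) ℝ V) (A : Matrix (Fin n) (Fin n) ℝ)
    (i j : Fin n) : Matrix.toBilin b A (b i) (b j) = A i j := by
  rw [← LinearMap.BilinForm.toMatrix_apply, LinearMap.BilinForm.toMatrix_toBilin]

lemma bilinForm_symm_of_basis (b : Module.Basis (Fin n) ℝ V) {φ : LinearMap.BilinForm ℝ V}
    (h : ∀ i j, φ (b i) (b j) = φ (b j) (b i)) (u v : V) : φ u v = φ v u := by
  have : LinearMap.flip φ = φ := LinearMap.ext_basis b b fun p q => by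
    rw [LinearMap.flip_apply]; exact (h p q).symm
  rw [← LinearMap.flip_apply (f := φ), this]

lemma offForm_apply (b : Module.Basis (Fin n) ℝ V) (i j p q : Fin n) :
    offForm b i j (b p) (b q) = (√2)⁻¹ * ((if p = i then 1 else 0) * (if q = j then 1 else 0)
      + (if p = j then 1 else 0) * (if q = i then 1 else 0)) := by
  rw [offForm, toBilin_apply_basis]; rfl

lemma diagForm_apply (b : Module.Basis (Fin n) ℝ V) (d : Fin n → ℝ) (p q : Fin n) :
    diagForm b d (b p) (b q) = if p = q then d p else 0 := by
  rw [diagForm, toBilin_apply_basis, Matrix.diagonal_apply]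

lemma tensorInner_offForm (b : Module.Basis (Fin n) ℝ V) (i j : Fin n)
    (ψ : LinearMap.BilinForm ℝ V) :
    tensorInner b (offForm b i j) ψ = (√2)⁻¹ * (ψ (b i) (b j) + ψ (b j) (b i)) := by
  simp only [tensorInner, offForm_apply, mul_add, add_mul, Finset.sum_add_distrib]
  simp

lemma tensorInner_diagForm (b : Module.Basis (Fin n) ℝ V) (d : Fin n → ℝ)
    (ψ : LinearMap.BilinForm ℝ V) :
    tensorInner b (diagForm b d) ψ = ∑ i, d i * ψ (b i) (b i) := by
  simp [tensorInner, diagForm_apply]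

lemma inv_sqrt_two_mul_self : (√2 : ℝ)⁻¹ * (√2)⁻¹ = 1 / 2 := by
  rw [← mul_inv, Real.mul_self_sqrt (by norm_num)]; norm_num

lemma secondKind_offForm (R : V → V → V → V → ℝ) (b : Module.Basis (Fin n) ℝ V) {i j : Fin n} :
    secondKind R b (offForm b i j) (offForm b i j) =
      (1 / 2) * (R (b i) (b i) (b j) (b j) + R (b i) (b j) (b i) (b j)
        + R (b j) (b i) (b j) (b i) + R (b j) (b j) (b i) (b i)) := by
  rw [← inv_sqrt_two_mul_self]
  simp only [secondKind, offForm_apply, mul_add, add_mul, Finset.sum_add_distrib]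
  simp [mul_assoc]
  ring

lemma secondKind_diagForm (R : V → V → V → V → ℝ) (b : Module.Basis (Fin n) ℝ V) (d : Fin n → ℝ) :
    secondKind R b (diagForm b d) (diagForm b d) =
      ∑ i, ∑ j, R (b i) (b j) (b j) (b i) * (d i * d j) := by
  simp only [secondKind, diagForm_apply]
  simp [mul_assoc]

/-- The system of all `(e_i ⊗ e_j + e_j ⊗ e_i) / √2`, `i < j`, and all `∑ D_{ai} e_i ⊗ e_i`,
`a ≠ z`. -/
def tracelessSystem (b : Module.Basis (Fin n) ℝ V) (D : Fin n → Fin n → ℝ) (z : Fin n) :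
    {p : Fin n × Fin n // p.1 < p.2} ⊕ {a : Fin n // a ≠ z} → LinearMap.BilinForm ℝ V :=
  Sum.elim (fun p => offForm b p.1.1 p.1.2) (fun a => diagForm b (D a))

/-- Row `z` of the orthogonal matrix `D` is constant and represents the trace direction.
Orthogonality to it makes the other rows traceless, and dropping it loses nothing on traceless
tensors. -/
lemma isOrthonormalBasisS20_tracelessSystem (b : Module.Basis (Fin n) ℝ V)
    (D : Fin n → Fin n → ℝ) (z : Fin n) {κ : ℝ} (hκ : κ ≠ 0) (hz : ∀ i, D z i = κ)
    (hrow : ∀ a c, ∑ i, D a i * D c i = if a = c then 1 else 0)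
    (hcol : ∀ i j, ∑ a, D a i * D a j = if i = j then 1 else 0) :
    IsOrthonormalBasisS20 b (tracelessSystem b D z) := by
  have htr : ∀ a, a ≠ z → ∑ i, D a i = 0 := by
    intro a ha
    have := hrow a z
    rw [if_neg ha] at this
    simp only [hz, ← Finset.sum_mul] at this
    exact (mul_eq_zero.1 this).resolve_right hκ
  constructor
  · rintro (⟨⟨i, j⟩, hij⟩ | ⟨a, ha⟩) (⟨⟨p, q⟩, hpq⟩ | ⟨c, hc⟩)
    · simp only at hij hpq
      simp only [tracelessSystem, Sum.elim_inl, tensorInner_offForm, offForm_apply]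
      by_cases h : i = p ∧ j = q
      · obtain ⟨rfl, rfl⟩ := h
        simp only [if_true, if_neg hij.ne, if_neg hij.ne']
        linarith [inv_sqrt_two_mul_self]
      · rw [if_neg (c := Sum.inl _ = Sum.inl _)
          (by simpa only [Sum.inl.injEq, Subtype.mk.injEq, Prod.mk.injEq] using h)]
        have h3 : ¬ (i = q ∧ j = p) := by rintro ⟨rfl, rfl⟩; exact lt_asymm hij hpq
        have e1 : ((if i = p then 1 else 0) * (if j = q then 1 else 0) : ℝ) = 0 := by
          split_ifs with h4 h5 <;> simp_all
        have e2 : ((if i = q then 1 else 0) * (if j = p then 1 else 0) : ℝ) = 0 := by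
          split_ifs with h4 h5 <;> simp_all
        rw [mul_comm] at e1 e2
        linear_combination (2 * (√2)⁻¹ * (√2)⁻¹) * (e1 + e2)
    · simp only at hij
      simp [tracelessSystem, tensorInner_offForm, diagForm_apply, hij.ne, hij.ne']
    · simp only at hpq
      simp only [tracelessSystem, Sum.elim_inl, Sum.elim_inr, tensorInner_diagForm, offForm_apply]
      rw [if_neg (by simp)]
      refine Finset.sum_eq_zero fun i _ => ?_
      split_ifs with h4 h5 <;> simp_all
    · simp [tracelessSystem, tensorInner_diagForm, diagForm_apply, hrow]
  · apply le_antisymm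
    · rw [Submodule.span_le]
      rintro _ ⟨⟨⟨i, j⟩, hij⟩ | ⟨a, ha⟩, rfl⟩
      · refine ⟨fun u v => ?_, ?_⟩
        · exact bilinForm_symm_of_basis (φ := offForm b i j) b
            (fun p q => by rw [offForm_apply, offForm_apply]; ring) u v
        · simp only at hij
          simp only [tracelessSystem, Sum.elim_inl, offForm_apply]
          refine Finset.sum_eq_zero fun i _ => ?_
          split_ifs with h4 h5 <;> simp_all
      · refine ⟨fun u v => ?_, ?_⟩
        · refine bilinForm_symm_of_basis (φ := diagForm b (D a)) b (fun p q => ?_) u v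
          rw [diagForm_apply, diagForm_apply]
          by_cases h : p = q
          · rw [h]
          · rw [if_neg h, if_neg (Ne.symm h)]
        · simp [tracelessSystem, diagForm_apply, htr a ha]
    · rintro φ ⟨hsym, htrφ⟩
      -- Spanning is proved by the explicit Fourier expansion of `φ`, compared on pairs of basis
      -- vectors. The off-diagonal tensors recover the entries with p ≠ q; the diagonal ones recover
      -- the rest, the missing row `z` having coefficient a multiple of the trace, that is 0.
      have hφ : φ = ∑ t, tensorInner b (tracelessSystem b D z t) φ • tracelessSystem b D z t := by
        refine LinearMap.ext_basis b b fun p q => ?_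
        rw [Fintype.sum_sum_type]
        simp only [tracelessSystem, Sum.elim_inl, Sum.elim_inr, tensorInner_offForm,
          tensorInner_diagForm, LinearMap.add_apply, LinearMap.sum_apply, LinearMap.smul_apply,
          offForm_apply, diagForm_apply, smul_eq_mul]
        have hoff := two_mul_sum_lt (fun i j => (√2)⁻¹ * (φ (b i) (b j) + φ (b j) (b i)) * 
            ((√2)⁻¹ * ((if p = i then 1 else 0) * (if q = j then 1 else 0)
              + (if p = j then 1 else 0) * (if q = i then 1 else 0)))) (by intros; ring)
        have hoff1 : ∑ i, ∑ j, (√2)⁻¹ * (φ (b i) (b j) + φ (b j) (b i)) * 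
            ((√2)⁻¹ * ((if p = i then 1 else 0) * (if q = j then 1 else 0)
              + (if p = j then 1 else 0) * (if q = i then 1 else 0))) = 2 * φ (b p) (b q) := by
          simp only [mul_add, add_mul, Finset.sum_add_distrib]
          simp
          rw [hsym (b q) (b p)]
          linear_combination 4 * φ (b p) (b q) * inv_sqrt_two_mul_self
        have hoff2 : ∑ i, (√2)⁻¹ * (φ (b i) (b i) + φ (b i) (b i)) * 
            ((√2)⁻¹ * ((if p = i then 1 else 0) * (if q = i then 1 else 0)
              + (if p = i then 1 else 0) * (if q = i then 1 else 0))) =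
            if p = q then 2 * φ (b p) (b p) else 0 := by
          split_ifs with h
          · subst h
            rw [Finset.sum_eq_single p (fun i _ hi => by simp [hi.symm]) (by simp)]
            simp only [if_true]
            linear_combination 4 * φ (b p) (b p) * inv_sqrt_two_mul_self
          · refine Finset.sum_eq_zero fun i _ => ?_
            split_ifs with h4 h5 <;> simp_all
        rw [hoff1, hoff2] at hoff
        have hdiag : ∑ a : {a // a ≠ z}, (∑ i, D a i * φ (b i) (b i)) *
            (if p = q then D a p else 0) = if p = q then φ (b p) (b p) else 0 := by
          split_ifs with h
          · rw [sum_subtype_ne z (fun a => (∑ i, D a i * φ (b i) (b i)) * D a p)]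
            have e1 : ∑ i, D z i * φ (b i) (b i) = 0 := by
              simp only [hz, ← Finset.mul_sum, htrφ, mul_zero]
            rw [e1, zero_mul, sub_zero]
            simp only [Finset.sum_mul]
            rw [Finset.sum_comm]
            have e2 : ∀ i, ∑ a, D a i * φ (b i) (b i) * D a p =
                if i = p then φ (b i) (b i) else 0 := by
              intro i
              have := congrArg (· * φ (b i) (b i)) (hcol i p)
              simp only [Finset.sum_mul, ite_mul, one_mul, zero_mul] at this
              rw [← this]
              exact Finset.sum_congr rfl fun a _ => by ring
            simp [e2]
          · simp
        rw [hdiag]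
        split_ifs at hoff ⊢ with h
        · subst h; linarith
        · linarith
      rw [hφ]
      exact Submodule.sum_mem _ fun t _ =>
        Submodule.smul_mem _ _ (Submodule.subset_span ⟨t, rfl⟩)

end Basis

/-! ### An orthogonal matrix adapted to a partition of the index set -/

/-- The normalized constant vector extends to an orthonormal basis; its vectors are the rows, and a
square matrix with orthonormal rows has orthonormal columns. -/
lemma exists_orthogonal_const_row {ι : Type*} [Fintype ι] [DecidableEq ι] (z : ι) :
    ∃ A : ι → ι → ℝ, (∀ i, A z i = (√(Fintype.card ι))⁻¹) ∧
      ∀ i j, ∑ a, A a i * A a j = if i = j then 1 else 0 := by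
  have hpos : (0 : ℝ) < Fintype.card ι := by exact_mod_cast Fintype.card_pos_iff.2 ⟨z⟩
  set v : ι → EuclideanSpace ℝ ι := fun _ => WithLp.toLp 2 fun _ => (√(Fintype.card ι))⁻¹
  have hv : Orthonormal ℝ (({z} : Set ι).domRestrict v) := by
    constructor
    · rintro ⟨i, _⟩
      change ‖v i‖ = 1
      rw [EuclideanSpace.norm_eq, Real.sqrt_eq_one]
      simp only [v, norm_inv, Real.norm_eq_abs, inv_pow, sq_abs, Real.sq_sqrt hpos.le,
        Finset.sum_const, Finset.card_univ, nsmul_eq_mul]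
      exact mul_inv_cancel₀ hpos.ne'
    · rintro ⟨i, hi⟩ ⟨j, hj⟩ hij
      exact absurd (Subtype.ext (hi.trans hj.symm)) hij
  obtain ⟨b, hb⟩ := hv.exists_orthonormalBasis_extension_of_card_eq (by simp)
  refine ⟨fun a i => b a i, fun i => by simp [hb z rfl, v], ?_⟩
  have h1 : (Matrix.of fun a i => b a i) * (Matrix.of fun a i => b a i).transpose = 1 := by
    ext a c
    have := b.inner_eq_ite c a
    rw [PiLp.inner_apply] at this
    simp only [Matrix.mul_apply, Matrix.of_apply, Matrix.transpose_apply, Matrix.one_apply]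
    simp only [RCLike.inner_apply, conj_trivial] at this
    rw [this]
    simp [eq_comm]
  intro i j
  have h3 := mul_eq_one_comm.1 h1
  have h2 := congrFun₂ h3 i j
  simpa [Matrix.mul_apply, Matrix.one_apply] using h2

lemma exists_block_orthogonal {ι : Type*} [DecidableEq ι] {s : Finset ι} {z : ι} (hz : z ∈ s) :
    ∃ A : ι → ι → ℝ, (∀ i ∈ s, A z i = (√(s.card : ℝ))⁻¹) ∧ (∀ a, ∀ i ∉ s, A a i = 0) ∧
      ∀ i ∈ s, ∀ j ∈ s, ∑ a ∈ s, A a i * A a j = if i = j then 1 else 0 := by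
  obtain ⟨A, hA1, hA2⟩ := exists_orthogonal_const_row (⟨z, hz⟩ : s)
  refine ⟨fun a i => if h : a ∈ s ∧ i ∈ s then A ⟨a, h.1⟩ ⟨i, h.2⟩ else 0, ?_, ?_, ?_⟩
  · intro i hi
    simp [hz, hi, hA1]
  · intro a i hi
    simp [hi]
  · intro i hi j hj
    have := hA2 ⟨i, hi⟩ ⟨j, hj⟩
    simp only [Subtype.mk.injEq] at this
    rw [← this, ← Finset.sum_coe_sort s]
    refine Finset.sum_congr rfl fun a _ => ?_
    simp [hi, hj]

/-- The value at `(i, j)` of the symmetric matrix with eigenvalues `0` on constant vectors, `1` on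
the vectors that are constant on `s` and on `sᶜ` with sum zero, `c₁` and `c₂` on the vectors with
sum zero supported in `s` and `sᶜ`. -/
def blockWeight {n : ℕ} (s : Finset (Fin n)) (k m c₁ c₂ : ℝ) (i j : Fin n) : ℝ :=
  if i ∈ s then
    if j ∈ s then c₁ * ((if i = j then 1 else 0) - 1 / k) + m / ((k + m) * k) else -1 / (k + m)
  else
    if j ∈ s then -1 / (k + m) else c₂ * ((if i = j then 1 else 0) - 1 / m) + k / ((k + m) * m)

/-- The weight of the diagonal tensor of index `a`. -/
def diagWeight {n : ℕ} (s : Finset (Fin n)) (z y : Fin n) (c₁ c₂ : ℝ) (a : Fin n) : ℝ :=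
  if a = z then 0 else if a = y then 1 else if a ∈ s then c₁ else c₂

/-- The rows of `D` are eigenvectors common to all the matrices `blockWeight`, whatever `c₁` and
`c₂`: the constant vector, the vector `ζ` separating the blocks, and vectors of sum zero in each
block. The last ones come from orthogonal matrices of the two blocks; their constant rows `z` and
`y` are replaced by the global constant and `ζ`, which span the same plane. -/
lemma exists_blockWeight_diagonalization {n : ℕ} {s : Finset (Fin n)} {z y : Fin n} (hz : z ∈ s)
    (hy : y ∉ s) {k m : ℝ} (hk : (s.card : ℝ) = k) (hm : (sᶜ.card : ℝ) = m) :
    ∃ D : Fin n → Fin n → ℝ, (∀ i, D z i = (√(k + m))⁻¹) ∧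
      ∀ c₁ c₂ i j, ∑ a, diagWeight s z y c₁ c₂ a * (D a i * D a j) =
        blockWeight s k m c₁ c₂ i j := by
  obtain ⟨A, hA1, hA2, hA3⟩ := exists_block_orthogonal hz
  obtain ⟨B, hB1, hB2, hB3⟩ := exists_block_orthogonal (Finset.mem_compl.2 hy)
  rw [hk] at hA1
  rw [hm] at hB1
  simp only [Finset.mem_compl, not_not] at hB1 hB2 hB3
  have hk0 : 0 < k := by rw [← hk]; exact_mod_cast Finset.card_pos.2 ⟨z, hz⟩
  have hm0 : 0 < m := by rw [← hm]; exact_mod_cast Finset.card_pos.2 ⟨y, Finset.mem_compl.2 hy⟩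
  have hzy : y ≠ z := by rintro rfl; exact hy hz
  -- The values are fixed by requiring constancy on both blocks, sum zero and norm one.
  set ζ : Fin n → ℝ := fun i => if i ∈ s then √(m / ((k + m) * k)) else -√(k / ((k + m) * m))
    with hζ
  refine ⟨fun a i => if a = z then (√(k + m))⁻¹ else if a = y then ζ i else
    if a ∈ s then A a i else B a i, fun i => if_pos rfl, fun c₁ c₂ i j => ?_⟩
  have e1 : ∀ a ∈ s, diagWeight s z y c₁ c₂ a *
      ((if a = z then (√(k + m))⁻¹ else if a = y then ζ i else if a ∈ s then A a i else B a i) *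
      (if a = z then (√(k + m))⁻¹ else if a = y then ζ j else if a ∈ s then A a j else B a j)) =
      c₁ * (A a i * A a j) - if a = z then c₁ * (A z i * A z j) else 0 := by
    intro a ha
    have hay : a ≠ y := by rintro rfl; exact hy ha
    by_cases h : a = z
    · subst h; simp [diagWeight]
    · simp [diagWeight, h, hay, ha]
  have e2 : ∀ a ∈ sᶜ, diagWeight s z y c₁ c₂ a *
      ((if a = z then (√(k + m))⁻¹ else if a = y then ζ i else if a ∈ s then A a i else B a i) *
      (if a = z then (√(k + m))⁻¹ else if a = y then ζ j else if a ∈ s then A a j else B a j)) =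
      c₂ * (B a i * B a j) + if a = y then ζ i * ζ j - c₂ * (B y i * B y j) else 0 := by
    intro a ha
    have ha := Finset.mem_compl.1 ha
    have haz : a ≠ z := by rintro rfl; exact ha hz
    by_cases h : a = y
    · subst h; simp [diagWeight, haz]
    · simp [diagWeight, h, haz, ha]
  rw [← Finset.sum_add_sum_compl s, Finset.sum_congr rfl e1, Finset.sum_congr rfl e2,
    Finset.sum_sub_distrib, Finset.sum_add_distrib, Finset.sum_ite_eq' s, if_pos hz,
    Finset.sum_ite_eq' sᶜ, if_pos (Finset.mem_compl.2 hy), ← Finset.mul_sum, ← Finset.mul_sum]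
  have hsq : ∀ x : ℝ, 0 ≤ x → √x * √x = x := fun x hx => Real.mul_self_sqrt hx
  have hcross : √(m / ((k + m) * k)) * √(k / ((k + m) * m)) = 1 / (k + m) := by
    rw [← Real.sqrt_mul (by positivity)]
    rw [show m / ((k + m) * k) * (k / ((k + m) * m)) = (1 / (k + m)) ^ 2 by field_simp]
    exact Real.sqrt_sq (by positivity)
  by_cases hi : i ∈ s <;> by_cases hj : j ∈ s
  · simp only [blockWeight, hi, hj, if_true, hA3 i hi j hj, hA1 i hi, hA1 j hj, hB2 _ i hi, hζ]
    rw [← mul_inv, hsq k hk0.le, hsq _ (by positivity)]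
    simp only [zero_mul, Finset.sum_const_zero]
    ring
  · simp only [blockWeight, hi, hj, if_true, if_false, hA2 _ j hj, hB2 _ i hi, hζ]
    simp only [zero_mul, mul_zero, Finset.sum_const_zero, mul_neg, hcross]
    ring
  · simp only [blockWeight, hi, hj, if_true, if_false, hA2 _ i hi, hB2 _ j hj, hζ]
    simp only [zero_mul, mul_zero, Finset.sum_const_zero, neg_mul]
    rw [mul_comm, hcross]
    ring
  · simp only [blockWeight, hi, hj, if_false, hB3 i hi j hj, hB1 i hi, hB1 j hj, hA2 _ i hi, hζ]
    rw [neg_mul_neg, ← mul_inv, hsq m hm0.le, hsq _ (by positivity)]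
    simp only [zero_mul, Finset.sum_const_zero]
    ring

/-! ### Curvature of a product under a condition on the curvature operator of the second kind -/

section Algebra

variable {n : ℕ} {V : Type*} [AddCommGroup V] [Module ℝ V]

lemma IsOrthonormalBasisS20.comp_equiv {ι κ : Type*} [DecidableEq ι] [DecidableEq κ] {e : Fin n → V}
    {φ : ι → LinearMap.BilinForm ℝ V} (h : IsOrthonormalBasisS20 e φ) (σ : κ ≃ ι) :
    IsOrthonormalBasisS20 e (φ ∘ σ) := by
  refine ⟨fun i j => ?_, ?_⟩
  · rw [Function.comp_apply, Function.comp_apply, h.1]; simp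
  · rw [Set.range_comp, σ.surjective.range_eq, Set.image_univ, h.2]

/-- Every permutation of an orthonormal basis is again one, which is the rearrangement hypothesis of
`weighted_sum_nonneg`. -/
lemma weighted_secondKind_nonneg {N : ℕ} {α : ℝ} (hα1 : 1 ≤ α) (hαN : α < N) (e : Fin n → V)
    (R : V → V → V → V → ℝ)
    (h : ∀ φ : Fin N → LinearMap.BilinForm ℝ V, IsOrthonormalBasisS20 e φ →
      0 ≤ fracSum α fun i => secondKind R e (φ i) (φ i))
    {ι : Type*} [Fintype ι] [DecidableEq ι] (hι : Fintype.card ι = N)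
    {φ : ι → LinearMap.BilinForm ℝ V} (hφ : IsOrthonormalBasisS20 e φ) (w : ι → ℝ)
    (hw0 : ∀ i, 0 ≤ w i) (hw1 : ∀ i, w i ≤ 1) (hw : α ≤ ∑ i, w i) :
    0 ≤ ∑ i, w i * secondKind R e (φ i) (φ i) := by
  set ε : Fin N ≃ ι := (Fintype.equivFinOfCardEq hι).symm
  rw [← Equiv.sum_comp ε]
  refine weighted_sum_nonneg hα1 hαN (fun i => secondKind R e (φ (ε i)) (φ (ε i)))
    (fun σ => h _ (hφ.comp_equiv (σ.trans ε))) (w ∘ ε) (fun i => hw0 _) (fun i => hw1 _) ?_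
  exact hw.trans_eq (Equiv.sum_comp ε w).symm

/-- The weight of the tensor `(e_i ⊗ e_j + e_j ⊗ e_i) / √2`. -/
def offWeight (s : Finset (Fin n)) (c₁ c₂ : ℝ) (i j : Fin n) : ℝ :=
  if i ∈ s then if j ∈ s then c₁ else 1 else if j ∈ s then 1 else c₂

lemma sum_ite_mem (s : Finset (Fin n)) (x y : ℝ) :
    ∑ i, (if i ∈ s then x else y) = s.card * x + sᶜ.card * y := by
  rw [← Finset.sum_add_sum_compl s, Finset.sum_congr rfl (fun i hi => if_pos hi),
    Finset.sum_congr rfl (fun i hi => if_neg (Finset.mem_compl.1 hi))]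
  simp

lemma sum_offWeight {s : Finset (Fin n)} {k m : ℝ} (hk : (s.card : ℝ) = k)
    (hm : (sᶜ.card : ℝ) = m) (c₁ c₂ : ℝ) :
    ∑ p : {p : Fin n × Fin n // p.1 < p.2}, offWeight s c₁ c₂ p.1.1 p.1.2 =
      c₁ * (k * (k - 1)) / 2 + k * m + c₂ * (m * (m - 1)) / 2 := by
  have h := two_mul_sum_lt (offWeight s c₁ c₂) (fun i j => by
    unfold offWeight; split_ifs <;> rfl)
  have h1 : ∀ i, ∑ j, offWeight s c₁ c₂ i j = if i ∈ s then k * c₁ + m else k + m * c₂ := by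
    intro i
    unfold offWeight
    split_ifs <;> rw [sum_ite_mem, hk, hm] <;> ring
  have h2 : ∀ i, offWeight s c₁ c₂ i i = if i ∈ s then c₁ else c₂ := by
    intro i; unfold offWeight; split_ifs <;> rfl
  simp only [h1, h2, sum_ite_mem, hk, hm] at h
  linarith

/-- The weighted sum of R̊ in the adapted basis is zero at a total weight strictly above α, and the
weight of the tensor attached to `i₀`, `j₀` is interior to [0,1]. Perturbing that one weight in both
directions keeps the sum nonnegative, so its coefficient vanishes. -/
lemma sectional_eq_zero_of_adapted {α : ℝ} (hα1 : 1 ≤ α) (b : Module.Basis (Fin n) ℝ V)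
    (R : V → V → V → V → ℝ)
    (h : ∀ φ : Fin ((n - 1) * (n + 2) / 2) → LinearMap.BilinForm ℝ V, IsOrthonormalBasisS20 b φ →
      0 ≤ fracSum α fun i => secondKind R b (φ i) (φ i))
    (hR1 : ∀ u v w z, R u v w z = -R v u w z) (hR2 : ∀ u v w z, R u v w z = -R u v z w)
    (s : Finset (Fin n)) {k m : ℝ} (hk : (s.card : ℝ) = k) (hm : (sᶜ.card : ℝ) = m)
    (hk1 : 1 ≤ k) (hm1 : 1 ≤ m) (hα : α < k * m + 2 * k * m / (k + m))
    (hmix : ∀ i ∈ s, ∀ j ∉ s, R (b i) (b j) (b i) (b j) = 0) {i₀ j₀ : Fin n} (hne : i₀ < j₀)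
    (hij : i₀ ∈ s ↔ j₀ ∈ s) : R (b i₀) (b j₀) (b i₀) (b j₀) = 0 := by
  have hn : (n : ℝ) = k + m := by
    rw [← hk, ← hm, ← Nat.cast_add, Finset.card_add_card_compl, Fintype.card_fin]
  obtain ⟨z, hz⟩ : s.Nonempty := Finset.card_pos.1 (by
    have : (0 : ℝ) < s.card := by linarith
    exact_mod_cast this)
  obtain ⟨y, hy⟩ : sᶜ.Nonempty := Finset.card_pos.1 (by
    have : (0 : ℝ) < sᶜ.card := by linarith
    exact_mod_cast this)
  have hy := Finset.mem_compl.1 hy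
  obtain ⟨D, hDz, hD⟩ := exists_blockWeight_diagonalization hz hy hk hm
  have hk0 : 0 < k := by linarith
  have hm0 : 0 < m := by linarith
  have hκ : (√(k + m))⁻¹ ≠ 0 := inv_ne_zero (Real.sqrt_pos.2 (by linarith)).ne'
  have hzy : y ≠ z := by rintro rfl; exact hy hz
  -- For c₁ = c₂ = 1 the weighted matrix is the identity minus the projection to constants; adding
  -- back row `z` gives the identity.
  have hcol : ∀ i j, ∑ a, D a i * D a j = if i = j then 1 else 0 := by
    intro i j
    have h1 := hD 1 1 i j
    have h2 : ∀ a, diagWeight s z y 1 1 a * (D a i * D a j) =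
        D a i * D a j - if a = z then D z i * D z j else 0 := by
      intro a
      unfold diagWeight
      split_ifs with h3 <;> simp [*]
    rw [Finset.sum_congr rfl fun a _ => h2 a, Finset.sum_sub_distrib,
      Finset.sum_ite_eq' Finset.univ,
      if_pos (Finset.mem_univ _), hDz, hDz, ← mul_inv, Real.mul_self_sqrt (by linarith)] at h1
    rw [sub_eq_iff_eq_add.1 h1]
    unfold blockWeight
    by_cases hi : i ∈ s <;> by_cases hj : j ∈ s
    · simp only [hi, hj, if_true]; field_simp; ring
    · have : i ≠ j := by rintro rfl; exact hj hi
      simp only [hi, hj, if_true, if_false, this]; field_simp; ring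
    · have : i ≠ j := by rintro rfl; exact hi hj
      simp only [hi, hj, if_true, if_false, this]; field_simp; ring
    · simp only [hi, hj, if_false]; field_simp; ring
  have hrow : ∀ a c, ∑ i, D a i * D c i = if a = c then 1 else 0 := by
    have h1 : (Matrix.of D).transpose * Matrix.of D = 1 := by
      ext i j
      simpa [Matrix.mul_apply, Matrix.one_apply] using hcol i j
    intro a c
    have h3 := mul_eq_one_comm.1 h1
    have h2 := congrFun₂ h3 a c
    simpa [Matrix.mul_apply, Matrix.one_apply] using h2
  have hbasis := isOrthonormalBasisS20_tracelessSystem b D z hκ hDz hrow hcol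
  have hcard : Fintype.card ({p : Fin n × Fin n // p.1 < p.2} ⊕ {a : Fin n // a ≠ z}) =
      (n - 1) * (n + 2) / 2 := by
    rw [Fintype.card_sum, card_subtype_lt, Fintype.card_subtype_compl, Fintype.card_subtype_eq,
      Fintype.card_fin]
    obtain ⟨l, rfl⟩ : ∃ l, n = l + 1 := ⟨n - 1, by have := z.pos; omega⟩
    simp only [Nat.add_sub_cancel]
    rw [show l * (l + 1 + 2) = (l + 1) * l + l * 2 by ring, Nat.add_mul_div_right _ _ (by norm_num)]
  have hN : ((((n - 1) * (n + 2) / 2 : ℕ) : ℝ)) = (k + m - 1) * (k + m + 2) / 2 := by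
    rw [← hcard, Fintype.card_sum, Nat.cast_add]
    have h1 := sum_offWeight hk hm 1 1
    have h2 : ∀ i j, offWeight s 1 1 i j = 1 := by
      intro i j; unfold offWeight; split_ifs <;> rfl
    simp only [h2, Finset.sum_const, Finset.card_univ, nsmul_eq_mul, mul_one] at h1
    rw [h1, Fintype.card_subtype_compl, Fintype.card_subtype_eq, Fintype.card_fin,
      Nat.cast_sub z.pos, hn]
    push_cast; ring
  -- By AM-GM the threshold is at most n²/4 + n/2, which is at most the dimension because n = k + m
  -- ≥ 2.
  have hαN : α < ((n - 1) * (n + 2) / 2 : ℕ) := by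
    rw [hN]
    refine hα.trans_le ?_
    have h1 : 2 * k * m / (k + m) ≤ (k + m) / 2 := by
      rw [div_le_div_iff₀ (by linarith) (by norm_num)]
      nlinarith [sq_nonneg (k - m)]
    nlinarith [sq_nonneg (k - m)]
  -- These solve c₁ = 2(m/((k+m)k) - c₁/k) and its mirror image for c₂, which is what the entrywise
  -- cancellation in `h3` below requires.
  set c₁ := 2 * m / ((k + m) * (k + 2)) with hc₁
  set c₂ := 2 * k / ((k + m) * (m + 2)) with hc₂
  have hc₁0 : 0 < c₁ := by positivity
  have hc₂0 : 0 < c₂ := by positivity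
  have hc₁1 : c₁ < 1 := by
    rw [hc₁, div_lt_one (by positivity)]; nlinarith [mul_pos hk0 hm0]
  have hc₂1 : c₂ < 1 := by
    rw [hc₂, div_lt_one (by positivity)]; nlinarith [mul_pos hk0 hm0]
  set p₀ : {p : Fin n × Fin n // p.1 < p.2} := ⟨(i₀, j₀), hne⟩
  set w : {p : Fin n × Fin n // p.1 < p.2} ⊕ {a : Fin n // a ≠ z} → ℝ :=
    Sum.elim (fun p => offWeight s c₁ c₂ p.1.1 p.1.2) (fun a => diagWeight s z y c₁ c₂ a) with hw
  have hdiag : ∀ f : Fin n → ℝ, ∑ a : {a : Fin n // a ≠ z}, diagWeight s z y c₁ c₂ a * f a =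
      ∑ a, diagWeight s z y c₁ c₂ a * f a := by
    intro f
    rw [sum_subtype_ne z fun a => diagWeight s z y c₁ c₂ a * f a]
    simp [diagWeight]
  have hwsum : ∑ t, w t = k * m + 2 * k * m / (k + m) := by
    rw [Fintype.sum_sum_type]
    simp only [hw, Sum.elim_inl, Sum.elim_inr]
    rw [sum_offWeight hk hm]
    -- The rows of `D` are unit vectors, so the eigenvalues add up to the trace of the block matrix.
    have h1 : ∑ a : {a : Fin n // a ≠ z}, diagWeight s z y c₁ c₂ a =
        ∑ i, blockWeight s k m c₁ c₂ i i := by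
      simp only [← hD]
      rw [Finset.sum_comm]
      simp only [← Finset.mul_sum, hrow, if_true]
      simpa using hdiag fun _ => 1
    have h2 : ∀ i, blockWeight s k m c₁ c₂ i i =
        if i ∈ s then c₁ * (1 - 1 / k) + m / ((k + m) * k)
        else c₂ * (1 - 1 / m) + k / ((k + m) * m) := by
      intro i; by_cases h : i ∈ s <;> simp [blockWeight, h]
    rw [h1, Finset.sum_congr rfl fun i _ => h2 i, sum_ite_mem, hk, hm, hc₁, hc₂]
    field_simp
    ring
  set S : {p : Fin n × Fin n // p.1 < p.2} ⊕ {a : Fin n // a ≠ z} → ℝ :=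
    fun t => secondKind R b (tracelessSystem b D z t) (tracelessSystem b D z t) with hS
  have hzero : ∀ u w z, R u u w z = 0 := fun u w z => by linarith [hR1 u u w z]
  have hSoff : ∀ p, S (Sum.inl p) = R (b p.1.1) (b p.1.2) (b p.1.1) (b p.1.2) := by
    intro p
    simp only [hS, tracelessSystem, Sum.elim_inl, secondKind_offForm, hzero]
    rw [hR1 (b p.1.2) (b p.1.1), hR2 (b p.1.1) (b p.1.2) (b p.1.2) (b p.1.1)]
    ring
  have hval : ∑ t, w t * S t = 0 := by
    rw [Fintype.sum_sum_type]
    simp only [hSoff]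
    simp only [hw, hS, Sum.elim_inl, Sum.elim_inr, tracelessSystem, secondKind_diagForm]
    rw [hdiag fun a => ∑ i, ∑ j, R (b i) (b j) (b j) (b i) * (D a i * D a j)]
    have h1 := two_mul_sum_lt (fun i j => offWeight s c₁ c₂ i j * R (b i) (b j) (b i) (b j)) (by
      intro i j
      rw [hR1 (b i) (b j), hR2 (b j) (b i) (b i) (b j)]
      unfold offWeight; split_ifs <;> ring)
    simp only [hzero, mul_zero, Finset.sum_const_zero, sub_zero] at h1
    have h2 : ∑ a, diagWeight s z y c₁ c₂ a *
        ∑ i, ∑ j, R (b i) (b j) (b j) (b i) * (D a i * D a j) =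
        ∑ i, ∑ j, R (b i) (b j) (b j) (b i) * blockWeight s k m c₁ c₂ i j := by
      simp only [← hD, Finset.mul_sum]
      rw [Finset.sum_comm]
      refine Finset.sum_congr rfl fun i _ => ?_
      rw [Finset.sum_comm]
      exact Finset.sum_congr rfl fun i _ => Finset.sum_congr rfl fun j _ => by ring
    rw [h2]
    -- The cancellation between off-diagonal and diagonal tensors already happens for each ordered
    -- pair (i, j). The factor 2 accounts for passing from pairs i < j to ordered pairs.
    have h3 : ∀ i j, offWeight s c₁ c₂ i j * R (b i) (b j) (b i) (b j) =
        -2 * (R (b i) (b j) (b j) (b i) * blockWeight s k m c₁ c₂ i j) := by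
      intro i j
      rw [hR2 (b i) (b j) (b j) (b i)]
      by_cases hij : i = j
      · subst hij; simp [hzero]
      by_cases hi : i ∈ s <;> by_cases hj : j ∈ s
      · simp only [offWeight, blockWeight, hi, hj, hij, if_true, if_false, hc₁]
        field_simp
        ring
      · simp [hmix i hi j hj]
      · have := hmix j hj i hi
        rw [hR1, hR2] at this
        rw [neg_neg] at this
        simp [this]
      · simp only [offWeight, blockWeight, hi, hj, hij, if_false, hc₂]
        field_simp
        ring
    have h4 : ∑ i, ∑ j, offWeight s c₁ c₂ i j * R (b i) (b j) (b i) (b j) =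
        -2 * ∑ i, ∑ j, R (b i) (b j) (b j) (b i) * blockWeight s k m c₁ c₂ i j := by
      simp only [h3, Finset.mul_sum]
    linarith
  have hbound : ∀ t, 0 ≤ w t ∧ w t ≤ 1 := by
    rintro (p | a) <;> simp only [hw, Sum.elim_inl, Sum.elim_inr, offWeight, diagWeight] <;>
      split_ifs <;> constructor <;> linarith
  have hbound₀ : 0 < w (Sum.inl p₀) ∧ w (Sum.inl p₀) < 1 := by
    simp only [hw, Sum.elim_inl, offWeight, p₀, hij]
    split_ifs <;> constructor <;> assumption
  have hpert : ∀ ε : ℝ, 0 ≤ w (Sum.inl p₀) + ε → w (Sum.inl p₀) + ε ≤ 1 →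
      α ≤ k * m + 2 * k * m / (k + m) + ε → 0 ≤ ε * R (b i₀) (b j₀) (b i₀) (b j₀) := by
    intro ε h0 h1 h2
    have h3 := weighted_secondKind_nonneg hα1 hαN b R h hcard hbasis
      (fun t => w t + if t = Sum.inl p₀ then ε else 0)
      (fun t => by
        by_cases ht : t = Sum.inl p₀
        · simpa [ht] using h0
        · simpa [ht] using (hbound t).1)
      (fun t => by
        by_cases ht : t = Sum.inl p₀
        · simpa [ht] using h1
        · simpa [ht] using (hbound t).2)
      (by rw [Finset.sum_add_distrib, hwsum, Finset.sum_ite_eq' Finset.univ]; simpa using h2)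
    simp only [add_mul, Finset.sum_add_distrib] at h3
    have h4 : ∑ t, w t * secondKind R b (tracelessSystem b D z t) (tracelessSystem b D z t) = 0 :=
      hval
    rw [h4, zero_add] at h3
    simp only [ite_mul, zero_mul, Finset.sum_ite_eq', Finset.mem_univ, if_true] at h3
    have h5 := hSoff p₀
    simp only [hS] at h5
    rwa [h5] at h3
  have hup := hpert (1 - w (Sum.inl p₀)) (by linarith) (by linarith) (by linarith [hbound₀.2])
  have hup' : 0 ≤ R (b i₀) (b j₀) (b i₀) (b j₀) :=
    nonneg_of_mul_nonneg_right hup (by linarith [hbound₀.2])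
  -- The largest decrease that keeps the weight nonnegative and the total at least α.
  set δ := min (w (Sum.inl p₀)) (k * m + 2 * k * m / (k + m) - α) with hδ
  have hδ0 : 0 < δ := lt_min hbound₀.1 (by linarith)
  have hδ1 : δ ≤ w (Sum.inl p₀) := min_le_left _ _
  have hδ2 : δ ≤ k * m + 2 * k * m / (k + m) - α := min_le_right _ _
  have hdown := hpert (-δ) (by linarith) (by linarith [hbound₀.2]) (by linarith)
  nlinarith

end Algebra

/-! ### Algebraic curvature tensors -/

section CurvatureLike

variable {V : Type*} [AddCommGroup V] [Module ℝ V]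

/-- The algebraic properties of `R(u,v,w,z) = g(R(u,v)z, w)`. -/
structure IsCurvatureLike (R : V → V → V → V → ℝ) : Prop where
  add : ∀ u u' v w z, R (u + u') v w z = R u v w z + R u' v w z
  smul : ∀ (c : ℝ) u v w z, R (c • u) v w z = c * R u v w z
  swap : ∀ u v w z, R u v w z = -R v u w z
  swap' : ∀ u v w z, R u v w z = -R u v z w
  bianchi : ∀ u v w z, R u v w z + R v z w u + R z u w v = 0

namespace IsCurvatureLike

variable {R : V → V → V → V → ℝ}

lemma neg (h : IsCurvatureLike R) : IsCurvatureLike fun u v w z => -R u v w z where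
  add u u' v w z := by rw [h.add]; ring
  smul c u v w z := by rw [h.smul]; ring
  swap u v w z := by rw [h.swap]
  swap' u v w z := by rw [h.swap']
  bianchi u v w z := by linarith [h.bianchi u v w z]

/-- The octahedron argument: four instances of the cyclic identity combine linearly, modulo the two
antisymmetries. -/
lemma pair (h : IsCurvatureLike R) (u v w z : V) : R u v w z = R w z u v := by
  have h1 := h.bianchi u v w z
  have h2 := h.bianchi v z u w
  have h3 := h.bianchi z w v u
  have h4 := h.bianchi w u z v
  linarith [h.swap u v w z, h.swap' u v w z, h.swap v z w u, h.swap' v z w u, h.swap z u w v,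
    h.swap' z u w v, h.swap v w u z, h.swap' v w u z, h.swap w z u v, h.swap' w z u v,
    h.swap z v u w, h.swap' z v u w, h.swap w u v z, h.swap' w u v z, h.swap u z w v,
    h.swap' u z w v, h.swap z w v u, h.swap' z w v u, h.swap' u z v w, h.swap' w u z v,
    h.swap' u v z w, h.swap' v w z u]

lemma add₂ (h : IsCurvatureLike R) (u v v' w z : V) :
    R u (v + v') w z = R u v w z + R u v' w z := by
  rw [h.swap, h.add, h.swap u v, h.swap u v']; ring

lemma add₃ (h : IsCurvatureLike R) (u v w w' z : V) :
    R u v (w + w') z = R u v w z + R u v w' z := by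
  rw [h.pair, h.add, h.pair w, h.pair w']

lemma add₄ (h : IsCurvatureLike R) (u v w z z' : V) :
    R u v w (z + z') = R u v w z + R u v w z' := by
  rw [h.pair, h.add₂, h.pair w, h.pair w z']

lemma smul₂ (h : IsCurvatureLike R) (c : ℝ) (u v w z : V) : R u (c • v) w z = c * R u v w z := by
  rw [h.swap, h.smul, h.swap u v]; ring

lemma smul₃ (h : IsCurvatureLike R) (c : ℝ) (u v w z : V) : R u v (c • w) z = c * R u v w z := by
  rw [h.pair, h.smul, h.pair w]

lemma smul₄ (h : IsCurvatureLike R) (c : ℝ) (u v w z : V) : R u v w (c • z) = c * R u v w z := by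
  rw [h.pair, h.smul₂, h.pair w]

lemma self_eq_zero (h : IsCurvatureLike R) (u w z : V) : R u u w z = 0 := by
  linarith [h.swap u u w z]

lemma eq_zero_of_sectional (h : IsCurvatureLike R) {W : Submodule ℝ V}
    (hW : ∀ u ∈ W, ∀ v ∈ W, R u v u v = 0) {u v w z : V} (hu : u ∈ W) (hv : v ∈ W) (hw : w ∈ W)
    (hz : z ∈ W) : R u v w z = 0 := by
  have h1 : ∀ u ∈ W, ∀ v ∈ W, ∀ w ∈ W, R u v u w = 0 := by
    intro u hu v hv w hw
    have := hW u hu (v + w) (W.add_mem hv hw)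
    rw [h.add₂, h.add₄, h.add₄, hW u hu v hv, hW u hu w hw, h.pair u w] at this
    linarith
  have h2 : ∀ u ∈ W, ∀ v ∈ W, ∀ w ∈ W, ∀ z ∈ W, R u v w z = -R w v u z := by
    intro u hu v hv w hw z hz
    have := h1 (u + w) (W.add_mem hu hw) v hv z hz
    rw [h.add, h.add₃, h.add₃, h1 u hu v hv z hz, h1 w hw v hv z hz] at this
    linarith
  have h3 : ∀ u ∈ W, ∀ v ∈ W, ∀ w ∈ W, ∀ z ∈ W, R u v w z = -R u z w v := by
    intro u hu v hv w hw z hz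
    rw [h.swap, h.swap', neg_neg, h2 v hv u hu z hz w hw, h.swap, h.swap', neg_neg]
  have e1 : R v z w u = R u v w z := by
    rw [h3 v hv z hz w hw u hu, h.swap, neg_neg]
  have e2 : R z u w v = R u v w z := by
    rw [h.swap, h3 u hu z hz w hw v hv, neg_neg]
  linarith [h.bianchi u v w z]

/-- By pair symmetry the mixed vanishing holds for the first two arguments as well. The Bianchi
identity then kills R(W₁,W₁,W₂,W₂), leaving only the two pure parts in the multilinear expansion. -/
lemma eq_zero_of_split (h : IsCurvatureLike R) {W₁ W₂ : Submodule ℝ V} (hsup : W₁ ⊔ W₂ = ⊤)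
    (hmix : ∀ u v, ∀ w ∈ W₁, ∀ z ∈ W₂, R u v w z = 0)
    (h1 : ∀ u ∈ W₁, ∀ v ∈ W₁, R u v u v = 0) (h2 : ∀ u ∈ W₂, ∀ v ∈ W₂, R u v u v = 0)
    (u v w z : V) : R u v w z = 0 := by
  have hmix' : ∀ u v, ∀ w ∈ W₂, ∀ z ∈ W₁, R u v w z = 0 := fun u v w hw z hz => by
    rw [h.swap', hmix u v z hz w hw, neg_zero]
  have hmix₁ : ∀ u ∈ W₁, ∀ v ∈ W₂, ∀ w z, R u v w z = 0 := fun u hu v hv w z => by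
    rw [h.pair, hmix w z u hu v hv]
  have hmix₁' : ∀ u ∈ W₂, ∀ v ∈ W₁, ∀ w z, R u v w z = 0 := fun u hu v hv w z => by
    rw [h.pair, hmix' w z u hu v hv]
  have h12 : ∀ u ∈ W₁, ∀ v ∈ W₁, ∀ w ∈ W₂, ∀ z ∈ W₂, R u v w z = 0 :=
    fun u hu v hv w hw z hz => by
      have := h.bianchi u v w z
      rwa [hmix₁ v hv z hz, hmix₁' z hz u hu, add_zero, add_zero] at this
  have h21 : ∀ u ∈ W₂, ∀ v ∈ W₂, ∀ w ∈ W₁, ∀ z ∈ W₁, R u v w z = 0 :=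
    fun u hu v hv w hw z hz => by rw [h.pair, h12 w hw z hz u hu v hv]
  have hdec : ∀ x : V, ∃ a ∈ W₁, ∃ b ∈ W₂, a + b = x := fun x =>
    Submodule.mem_sup.1 (hsup ▸ Submodule.mem_top)
  obtain ⟨u₁, hu₁, u₂, hu₂, rfl⟩ := hdec u
  obtain ⟨v₁, hv₁, v₂, hv₂, rfl⟩ := hdec v
  obtain ⟨w₁, hw₁, w₂, hw₂, rfl⟩ := hdec w
  obtain ⟨z₁, hz₁, z₂, hz₂, rfl⟩ := hdec z
  simp only [h.add, h.add₂, h.add₃, h.add₄]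
  rw [h.eq_zero_of_sectional h1 hu₁ hv₁ hw₁ hz₁, h.eq_zero_of_sectional h2 hu₂ hv₂ hw₂ hz₂]
  simp only [hmix _ _ w₁ hw₁ z₂ hz₂, hmix' _ _ w₂ hw₂ z₁ hz₁, hmix₁ u₁ hu₁ v₂ hv₂,
    hmix₁' u₂ hu₂ v₁ hv₁, h12 u₁ hu₁ v₁ hv₁ w₂ hw₂ z₂ hz₂, h21 u₂ hu₂ v₂ hv₂ w₁ hw₁ z₁ hz₁,
    add_zero]

end IsCurvatureLike

end CurvatureLike

/-! ### Adapted orthonormal frames -/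

/-- The given pair is placed in positions 0 and 1 of an orthonormal basis of `W₁`, followed by one
of `W₂`. The pair itself guarantees that `W₁` has dimension at least 2. -/
lemma exists_adapted_orthonormal_basis {n k m : ℕ} (hn : k + m = n) {V : Type*}
    [NormedAddCommGroup V] [InnerProductSpace ℝ V] [FiniteDimensional ℝ V]
    (hV : Module.finrank ℝ V = n) {W₁ W₂ : Submodule ℝ V} (h1 : Module.finrank ℝ W₁ = k)
    (h2 : Module.finrank ℝ W₂ = m) (hW : ∀ a ∈ W₁, ∀ b ∈ W₂, inner ℝ a b = 0) {u v : V}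
    (hu : u ∈ W₁) (hv : v ∈ W₁) (huu : inner ℝ u u = 1) (hvv : inner ℝ v v = 1)
    (huv : inner ℝ u v = 0) :
    ∃ (b : Module.Basis (Fin n) ℝ V) (s : Finset (Fin n)) (i₀ j₀ : Fin n),
      (∀ i j, inner ℝ (b i) (b j) = if i = j then 1 else 0) ∧ s.card = k ∧ sᶜ.card = m ∧
      (∀ i ∈ s, b i ∈ W₁) ∧ (∀ i ∉ s, b i ∈ W₂) ∧ i₀ < j₀ ∧ i₀ ∈ s ∧ j₀ ∈ s ∧
      b i₀ = u ∧ b j₀ = v := by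
  subst hn
  have hk : 2 ≤ k := by
    have hli : LinearIndependent ℝ ![(⟨u, hu⟩ : W₁), ⟨v, hv⟩] := by
      refine LinearIndependent.pair_iff.2 fun a c hac => ?_
      have hac' : a • u + c • v = 0 := congrArg Subtype.val hac
      have e1 := congrArg (fun x => inner ℝ x u) hac'
      have e2 := congrArg (fun x => inner ℝ x v) hac'
      simp only [inner_add_left, inner_smul_left, huu, hvv, huv, real_inner_comm u v,
        inner_zero_left] at e1 e2
      simp at e1 e2
      exact ⟨e1, e2⟩
    have := hli.fintype_card_le_finrank
    simpa [h1] using this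
  -- Only the values at 0 and 1 matter: the extension below agrees with `f` on `T` alone.
  set f : Fin k → W₁ := fun i => if (i : ℕ) = 0 then ⟨u, hu⟩ else ⟨v, hv⟩ with hf
  set T : Set (Fin k) := {i | (i : ℕ) ≤ 1}
  have hfT : Orthonormal ℝ (T.domRestrict f) := by
    rw [orthonormal_iff_ite]
    rintro ⟨i, hi⟩ ⟨j, hj⟩
    change (i : ℕ) ≤ 1 at hi
    change (j : ℕ) ≤ 1 at hj
    change inner ℝ (f i) (f j) = _
    simp only [hf, Subtype.mk.injEq, Fin.ext_iff]
    rw [Submodule.coe_inner]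
    by_cases h3 : (i : ℕ) = 0 <;> by_cases h4 : (j : ℕ) = 0
    · simp only [h3, h4, if_true, huu]
    · simp [h3, h4, huv, Ne.symm h4]
    · simp [h3, h4, real_inner_comm u v, huv]
    · have : (i : ℕ) = j := by omega
      rw [if_neg h3, if_neg h4, if_pos this, hvv]
  obtain ⟨b₁, hb₁⟩ := hfT.exists_orthonormalBasis_extension_of_card_eq (by simp [h1])
  set b₂ : OrthonormalBasis (Fin m) ℝ W₂ := (stdOrthonormalBasis ℝ W₂).reindex (finCongr h2)
  set e : Fin (k + m) → V := fun i => Fin.addCases (fun a => (b₁ a : V)) (fun c => (b₂ c : V)) i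
  have he1 : ∀ a, e (Fin.castAdd m a) = b₁ a := fun a => by simp [e]
  have he2 : ∀ c, e (Fin.natAdd k c) = b₂ c := fun a => by simp [e]
  have hon : ∀ i j, inner ℝ (e i) (e j) = if i = j then (1 : ℝ) else 0 := by
    intro i j
    refine Fin.addCases (fun a => ?_) (fun a => ?_) i <;>
      refine Fin.addCases (fun c => ?_) (fun c => ?_) j
    · rw [he1, he1, ← Submodule.coe_inner, b₁.inner_eq_ite]; simp
    · rw [he1, he2, hW _ (b₁ a).2 _ (b₂ c).2, if_neg]
      intro h; have := congrArg Fin.val h; simp at this; omega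
    · rw [he1, he2, real_inner_comm, hW _ (b₁ c).2 _ (b₂ a).2, if_neg]
      intro h; have := congrArg Fin.val h; simp at this; omega
    · rw [he2, he2, ← Submodule.coe_inner, b₂.inner_eq_ite]; simp
  have hor : Orthonormal ℝ e := orthonormal_iff_ite.2 hon
  have : Nonempty (Fin (k + m)) := ⟨⟨0, by omega⟩⟩
  set b := basisOfOrthonormalOfCardEqFinrank hor (by simp [hV])
  have hb : ⇑b = e := coe_basisOfOrthonormalOfCardEqFinrank hor _
  set s : Finset (Fin (k + m)) := Finset.univ.map (Fin.castAddEmb m)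
  have hs : s.card = k := by simp [s]
  have hmem : ∀ i, i ∈ s ↔ ∃ a, Fin.castAdd m a = i := by intro i; simp [s]
  refine ⟨b, s, Fin.castAdd m ⟨0, by omega⟩, Fin.castAdd m ⟨1, by omega⟩, by rwa [hb], hs, ?_, ?_,
    ?_, by simp [Fin.lt_def], (hmem _).2 ⟨_, rfl⟩, (hmem _).2 ⟨_, rfl⟩, ?_, ?_⟩
  · rw [Finset.card_compl, hs]; simp
  · intro i hi
    obtain ⟨a, rfl⟩ := (hmem i).1 hi
    rw [hb, he1]; exact (b₁ a).2
  · intro i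
    refine Fin.addCases (fun a => ?_) (fun a => ?_) i
    · intro h; exact absurd ((hmem _).2 ⟨a, rfl⟩) h
    · intro _; rw [hb, he2]; exact (b₂ a).2
  · rw [hb, he1, hb₁ _ (by simp [T])]; simp [hf]
  · rw [hb, he1, hb₁ _ (by simp [T])]; simp [hf]

section Split

variable {n k m : ℕ} {V : Type*} [AddCommGroup V] [Module ℝ V] [FiniteDimensional ℝ V]

/-- The form `g` is turned into a local inner product structure on `V`, so that the previous lemma
applies. -/
lemma exists_adapted_frame (hn : k + m = n) (hV : Module.finrank ℝ V = n)
    (g : LinearMap.BilinForm ℝ V) (hsymm : ∀ u v, g u v = g v u) (hpos : ∀ u, u ≠ 0 → 0 < g u u)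
    {W₁ W₂ : Submodule ℝ V} (h1 : Module.finrank ℝ W₁ = k)
    (h2 : Module.finrank ℝ W₂ = m) (hW : ∀ a ∈ W₁, ∀ b ∈ W₂, g a b = 0) {u v : V}
    (hu : u ∈ W₁) (hv : v ∈ W₁) (huu : g u u = 1) (hvv : g v v = 1) (huv : g u v = 0) :
    ∃ (b : Module.Basis (Fin n) ℝ V) (s : Finset (Fin n)) (i₀ j₀ : Fin n),
      (∀ i j, g (b i) (b j) = if i = j then 1 else 0) ∧ s.card = k ∧ sᶜ.card = m ∧
      (∀ i ∈ s, b i ∈ W₁) ∧ (∀ i ∉ s, b i ∈ W₂) ∧ i₀ < j₀ ∧ i₀ ∈ s ∧ j₀ ∈ s ∧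
      b i₀ = u ∧ b j₀ = v := by
  let core : InnerProductSpace.Core ℝ V :=
    { inner := fun a c => g a c
      conj_inner_symm := fun a c => by simp [hsymm a c]
      re_inner_nonneg := fun a => by
        by_cases h : a = 0
        · simp [h]
        · simpa using (hpos a h).le
      add_left := fun a c d => by simp
      smul_left := fun a c r => by simp
      definite := fun a ha => by
        by_contra h
        exact (hpos a h).ne' ha }
  let _ : NormedAddCommGroup V := core.toNormedAddCommGroup
  let _ : InnerProductSpace ℝ V := InnerProductSpace.ofCore core.toCore
  exact exists_adapted_orthonormal_basis hn hV h1 h2 hW hu hv huu hvv huv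

/-- Gram-Schmidt reduces an arbitrary pair in `W₁` to an orthonormal one: R(u,v,u,v) does not change
when a multiple of `u` is subtracted from `v`, and it scales by squares. -/
lemma sectional_eq_zero_of_split (hn : k + m = n) (hV : Module.finrank ℝ V = n) (hk : 1 ≤ k)
    (hm : 1 ≤ m) {α : ℝ} (hα1 : 1 ≤ α)
    (hα : α < (k : ℝ) * m + 2 * k * m / ((k : ℝ) + m))
    (g : LinearMap.BilinForm ℝ V) (hsymm : ∀ u v, g u v = g v u) (hpos : ∀ u, u ≠ 0 → 0 < g u u)
    {R : V → V → V → V → ℝ} (hR : IsCurvatureLike R)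
    (h : ∀ e : Fin n → V, (∀ i j, g (e i) (e j) = if i = j then 1 else 0) →
      ∀ φ : Fin ((n - 1) * (n + 2) / 2) → LinearMap.BilinForm ℝ V, IsOrthonormalBasisS20 e φ →
        0 ≤ fracSum α fun i => secondKind R e (φ i) (φ i))
    {W₁ W₂ : Submodule ℝ V} (h1 : Module.finrank ℝ W₁ = k)
    (h2 : Module.finrank ℝ W₂ = m) (hW : ∀ a ∈ W₁, ∀ b ∈ W₂, g a b = 0)
    (hmix : ∀ u v, ∀ w ∈ W₁, ∀ z ∈ W₂, R u v w z = 0) {u v : V} (hu : u ∈ W₁) (hv : v ∈ W₁) :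
    R u v u v = 0 := by
  have hunit : ∀ u ∈ W₁, ∀ v ∈ W₁, g u u = 1 → g v v = 1 → g u v = 0 → R u v u v = 0 := by
    intro u hu v hv huu hvv huv
    obtain ⟨b, s, i₀, j₀, hb, hsk, hsm, hb1, hb2, hij, hi, hj, rfl, rfl⟩ :=
      exists_adapted_frame hn hV g hsymm hpos h1 h2 hW hu hv huu hvv huv
    exact sectional_eq_zero_of_adapted hα1 b R (h b hb) hR.swap hR.swap' s (k := k) (m := m)
      (by exact_mod_cast hsk) (by exact_mod_cast hsm) (by exact_mod_cast hk) (by exact_mod_cast hm)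
      hα (fun i hi j hj => hmix _ _ _ (hb1 i hi) _ (hb2 j hj)) hij (by simp [hi, hj])
  have hnormal : ∀ u : V, u ≠ 0 → g ((√(g u u))⁻¹ • u) ((√(g u u))⁻¹ • u) = 1 := by
    intro u hu
    have h3 := hpos u hu
    simp only [map_smul, LinearMap.smul_apply, smul_eq_mul]
    rw [← mul_assoc, ← mul_inv, Real.mul_self_sqrt h3.le, inv_mul_cancel₀ h3.ne']
  by_cases hu0 : u = 0
  · subst hu0
    simpa using hR.smul 0 0 v 0 v
  have hgu := hpos u hu0
  set t := v - (g u v / g u u) • u with ht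
  have htW : t ∈ W₁ := W₁.sub_mem hv (W₁.smul_mem _ hu)
  have hut : g u t = 0 := by
    simp only [ht, map_sub, map_smul, smul_eq_mul]
    field_simp
    ring
  have hvt : v = t + (g u v / g u u) • u := by simp [ht]
  have hRt : R u v u v = R u t u t := by
    rw [hvt, hR.add₂, hR.add₄, hR.smul₂, hR.smul₄, hR.self_eq_zero,
      hR.swap' u t u u, hR.pair u t u u, hR.self_eq_zero]
    simp
  rw [hRt]
  by_cases ht0 : t = 0
  · rw [ht0]
    simpa using hR.smul₂ 0 u 0 u 0
  have hgt := hpos t ht0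
  have := hunit _ (W₁.smul_mem (√(g u u))⁻¹ hu) _ (W₁.smul_mem (√(g t t))⁻¹ htW) (hnormal u hu0)
    (hnormal t ht0) (by simp [hut])
  rw [hR.smul, hR.smul₂, hR.smul₃, hR.smul₄] at this
  have e1 : (√(g u u))⁻¹ ≠ 0 := inv_ne_zero (Real.sqrt_pos.2 hgu).ne'
  have e2 : (√(g t t))⁻¹ ≠ 0 := inv_ne_zero (Real.sqrt_pos.2 hgt).ne'
  simpa [e1, e2] using this

/-- A curvature tensor that splits along an orthogonal decomposition with factors of dimensions
`k` and `m`, and whose curvature operator of the second kind is `α`-nonnegative for some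
`α < km + 2km/(k+m)`, vanishes. -/
lemma curvature_eq_zero_of_split (hn : k + m = n) (hV : Module.finrank ℝ V = n) (hk : 1 ≤ k)
    (hm : 1 ≤ m) {α : ℝ} (hα1 : 1 ≤ α)
    (hα : α < (k : ℝ) * m + 2 * k * m / ((k : ℝ) + m))
    (g : LinearMap.BilinForm ℝ V) (hsymm : ∀ u v, g u v = g v u) (hpos : ∀ u, u ≠ 0 → 0 < g u u)
    {R : V → V → V → V → ℝ} (hR : IsCurvatureLike R)
    (h : ∀ e : Fin n → V, (∀ i j, g (e i) (e j) = if i = j then 1 else 0) →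
      ∀ φ : Fin ((n - 1) * (n + 2) / 2) → LinearMap.BilinForm ℝ V, IsOrthonormalBasisS20 e φ →
        0 ≤ fracSum α fun i => secondKind R e (φ i) (φ i))
    {W₁ W₂ : Submodule ℝ V} (hsup : W₁ ⊔ W₂ = ⊤) (h1 : Module.finrank ℝ W₁ = k)
    (h2 : Module.finrank ℝ W₂ = m) (hW : ∀ a ∈ W₁, ∀ b ∈ W₂, g a b = 0)
    (hmix : ∀ u v, ∀ w ∈ W₁, ∀ z ∈ W₂, R u v w z = 0) (u v w z : V) : R u v w z = 0 := by
  refine hR.eq_zero_of_split hsup hmix (fun u hu v hv => ?_) (fun u hu v hv => ?_) u v w z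
  · exact sectional_eq_zero_of_split hn hV hk hm hα1 hα g hsymm hpos hR h h1 h2 hW hmix hu hv
  -- The hypotheses, including the bound on α, are symmetric in the two factors.
  · refine sectional_eq_zero_of_split ((add_comm m k).trans hn) hV hm hk hα1 ?_ g hsymm hpos hR h
      h2 h1 (fun a ha b hb => (hsymm a b).trans (hW b hb a ha)) (fun u v w hw z hz => ?_) hu hv
    · rwa [mul_comm (m : ℝ), mul_assoc 2 (m : ℝ), mul_comm (m : ℝ), ← mul_assoc, add_comm (m : ℝ)]
    · rw [hR.swap', hmix u v z hz w hw, neg_zero]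

end Split

/-! ### Metric connections on open subsets of normed spaces -/

section Connection

variable {E : Type*} [NormedAddCommGroup E] [NormedSpace ℝ E]

/-- `Γ` is the Levi-Civita connection of the metric `G` near `c`. -/
structure IsLeviCivitaAt (G : E → E →L[ℝ] E →L[ℝ] ℝ) (Γ : E → E →L[ℝ] E →L[ℝ] E) (c : E) :
    Prop where
  contDiffAt_metric : ContDiffAt ℝ 2 G c
  contDiffAt_connection : ContDiffAt ℝ 1 Γ c
  metric_symm : ∀ᶠ x in 𝓝 c, ∀ u v, G x u v = G x v u
  torsion_free : ∀ᶠ x in 𝓝 c, ∀ u v, Γ x u v = Γ x v u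
  compat : ∀ᶠ x in 𝓝 c, ∀ u a b, fderiv ℝ G x u a b = G x (Γ x u a) b + G x a (Γ x u b)

/-- The curvature `R(u,v)w` of the connection `Γ` at `c`. -/
def connectionCurvature (Γ : E → E →L[ℝ] E →L[ℝ] E) (c u v w : E) : E :=
  fderiv ℝ Γ c u v w - fderiv ℝ Γ c v u w + Γ c u (Γ c v w) - Γ c v (Γ c u w)

variable {G : E → E →L[ℝ] E →L[ℝ] ℝ} {Γ : E → E →L[ℝ] E →L[ℝ] E} {c : E}

lemma connectionCurvature_swap (u v w : E) :
    connectionCurvature Γ c u v w = -connectionCurvature Γ c v u w := by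
  unfold connectionCurvature; abel

namespace IsLeviCivitaAt

lemma fderiv_connection_symm (h : IsLeviCivitaAt G Γ c) (u v w : E) :
    fderiv ℝ Γ c u v w = fderiv ℝ Γ c u w v := by
  have hd : DifferentiableAt ℝ Γ c := h.contDiffAt_connection.differentiableAt (by norm_num)
  have h1 : ∀ a b, fderiv ℝ (fun x => Γ x a b) c u = fderiv ℝ Γ c u a b := by
    intro a b
    have := (hd.hasFDerivAt.clm_apply (hasFDerivAt_const a c)).clm_apply (hasFDerivAt_const b c)
    rw [this.fderiv]
    simp
  rw [← h1, ← h1]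
  have : (fun x => Γ x v w) =ᶠ[𝓝 c] fun x => Γ x w v := by
    filter_upwards [h.torsion_free] with x hx using hx v w
  rw [this.fderiv_eq]

lemma curvature_bianchi (h : IsLeviCivitaAt G Γ c) (u v w : E) :
    connectionCurvature Γ c u v w + connectionCurvature Γ c v w u +
      connectionCurvature Γ c w u v = 0 := by
  have hs := h.torsion_free.self_of_nhds
  unfold connectionCurvature
  rw [h.fderiv_connection_symm u v w, h.fderiv_connection_symm v w u,
    h.fderiv_connection_symm w u v, hs v w, hs u w, hs v u]
  abel

set_option maxSynthPendingDepth 8 in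
-- Differentiating metric compatibility once more expresses the second derivative of `G` through Γ
-- and its derivative. Symmetry of second derivatives makes the antisymmetrization in `u`, `v`
-- vanish, and what remains is this identity.
lemma metric_curvature_swap (h : IsLeviCivitaAt G Γ c) (u v a b : E) :
    G c (connectionCurvature Γ c u v a) b = -G c (connectionCurvature Γ c u v b) a := by
  have hdG : DifferentiableAt ℝ G c := h.contDiffAt_metric.differentiableAt (by norm_num)
  have hdΓ : DifferentiableAt ℝ Γ c := h.contDiffAt_connection.differentiableAt (by norm_num)
  have hd2 : DifferentiableAt ℝ (fderiv ℝ G) c :=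
    (h.contDiffAt_metric.fderiv_right (m := 1) (by norm_num)).differentiableAt (by norm_num)
  have hc := h.compat.self_of_nhds
  have hsymm := h.metric_symm.self_of_nhds
  have key : ∀ u v, fderiv ℝ (fderiv ℝ G) c u v a b =
      G c (fderiv ℝ Γ c u v a) b + G c (Γ c u (Γ c v a)) b + G c (Γ c v a) (Γ c u b) +
      G c a (fderiv ℝ Γ c u v b) + G c a (Γ c u (Γ c v b)) + G c (Γ c u a) (Γ c v b) := by
    intro u v
    have e1 : HasFDerivAt (fun x => fderiv ℝ G x v a b) _ c :=
      ((hd2.hasFDerivAt.clm_apply (hasFDerivAt_const v c)).clm_apply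
        (hasFDerivAt_const a c)).clm_apply (hasFDerivAt_const b c)
    have e2 : ∀ a, HasFDerivAt (fun x => Γ x v a) _ c := fun a =>
      (hdΓ.hasFDerivAt.clm_apply (hasFDerivAt_const v c)).clm_apply (hasFDerivAt_const a c)
    have e3 : HasFDerivAt (fun x => G x (Γ x v a) b + G x a (Γ x v b)) _ c :=
      ((hdG.hasFDerivAt.clm_apply (e2 a)).clm_apply (hasFDerivAt_const b c)).add
        ((hdG.hasFDerivAt.clm_apply (hasFDerivAt_const a c)).clm_apply (e2 b))
    have e4 : (fun x => fderiv ℝ G x v a b) =ᶠ[𝓝 c]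
        fun x => G x (Γ x v a) b + G x a (Γ x v b) := by
      filter_upwards [h.compat] with x hx using hx v a b
    have e5 := congrArg (fun L : E →L[ℝ] ℝ => L u) (e1.unique (e3.congr_of_eventuallyEq e4))
    simp at e5
    rw [e5, hc, hc]
    ring
  have hs : fderiv ℝ (fderiv ℝ G) c u v = fderiv ℝ (fderiv ℝ G) c v u :=
    h.contDiffAt_metric.isSymmSndFDerivAt (by simp) u v
  have hk : fderiv ℝ (fderiv ℝ G) c u v a b = fderiv ℝ (fderiv ℝ G) c v u a b := by rw [hs]
  rw [key u v, key v u] at hk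
  rw [hsymm (connectionCurvature Γ c u v b) a]
  simp only [connectionCurvature, map_add, map_sub, add_apply,
    sub_apply]
  linarith

/-- The curvature tensor of a Levi-Civita connection has the algebraic symmetries. -/
lemma isCurvatureLike (h : IsLeviCivitaAt G Γ c) :
    IsCurvatureLike fun u v w z => G c (connectionCurvature Γ c u v z) w where
  add u u' v w z := by
    simp only [connectionCurvature, map_add, map_sub, add_apply,
      sub_apply]
    ring
  smul r u v w z := by
    simp only [connectionCurvature, map_add, map_sub, map_smul, add_apply,
      sub_apply, smul_apply, smul_eq_mul]
    ring
  swap u v w z := by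
    rw [connectionCurvature_swap u v z]; simp
  swap' u v w z := h.metric_curvature_swap u v z w
  bianchi u v w z := by
    have := congrArg (fun x => G c x w) (h.curvature_bianchi u v z)
    simpa using this

end IsLeviCivitaAt

/-! ### Vector fields along a map -/

section Along

variable {F : Type*} [NormedAddCommGroup F] [NormedSpace ℝ F]

/-- The covariant derivative in direction `u` of the vector field `W` along `ψ`. -/
def covAlong (Γ : E → E →L[ℝ] E →L[ℝ] E) (ψ : F → E) (u : F) (W : F → E) (y : F) : E :=
  fderiv ℝ W y u + Γ (ψ y) (fderiv ℝ ψ y u) (W y)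

variable {ψ : F → E} {y : F}

lemma fderiv_metric_along (hG : DifferentiableAt ℝ G (ψ y)) (hψ : DifferentiableAt ℝ ψ y)
    (hc : ∀ u a b, fderiv ℝ G (ψ y) u a b =
      G (ψ y) (Γ (ψ y) u a) b + G (ψ y) a (Γ (ψ y) u b))
    {W₁ W₂ : F → E} (h₁ : DifferentiableAt ℝ W₁ y) (h₂ : DifferentiableAt ℝ W₂ y) (u : F) :
    fderiv ℝ (fun y => G (ψ y) (W₁ y) (W₂ y)) y u =
      G (ψ y) (covAlong Γ ψ u W₁ y) (W₂ y) + G (ψ y) (W₁ y) (covAlong Γ ψ u W₂ y) := by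
  have e1 : HasFDerivAt (fun y => G (ψ y)) _ y :=
    HasFDerivAt.comp (g := G) y hG.hasFDerivAt hψ.hasFDerivAt
  have e2 : HasFDerivAt (fun y => G (ψ y) (W₁ y) (W₂ y)) _ y :=
    (e1.clm_apply h₁.hasFDerivAt).clm_apply h₂.hasFDerivAt
  rw [e2.fderiv]
  simp [covAlong, hc]
  ring

lemma differentiableAt_covAlong (hΓ : DifferentiableAt ℝ Γ (ψ y)) (hψ : ContDiffAt ℝ 2 ψ y)
    {W : F → E} (hW : ContDiffAt ℝ 2 W y) (u : F) : DifferentiableAt ℝ (covAlong Γ ψ u W) y := by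
  have h1 : DifferentiableAt ℝ (fderiv ℝ ψ) y :=
    (hψ.fderiv_right (m := 1) (by norm_num)).differentiableAt (by norm_num)
  have h2 : DifferentiableAt ℝ (fderiv ℝ W) y :=
    (hW.fderiv_right (m := 1) (by norm_num)).differentiableAt (by norm_num)
  have h3 : DifferentiableAt ℝ (fun y => Γ (ψ y)) y :=
    DifferentiableAt.comp (g := Γ) y hΓ (hψ.differentiableAt (by norm_num))
  exact (h2.clm_apply (differentiableAt_const u)).add
    ((h3.clm_apply (h1.clm_apply (differentiableAt_const u))).clm_apply
      (hW.differentiableAt (by norm_num)))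

/-- The second derivatives of `W` and of `ψ` are symmetric and drop out. Working along `ψ` evaluates
the curvature in the chart of `M` on product coordinate fields, with no need for its invariance
under isometries. -/
lemma covAlong_commutator (hΓ : DifferentiableAt ℝ Γ (ψ y)) (hψ : ContDiffAt ℝ 2 ψ y)
    {W : F → E} (hW : ContDiffAt ℝ 2 W y) (u v : F) :
    covAlong Γ ψ u (covAlong Γ ψ v W) y - covAlong Γ ψ v (covAlong Γ ψ u W) y =
      connectionCurvature Γ (ψ y) (fderiv ℝ ψ y u) (fderiv ℝ ψ y v) (W y) := by
  have h1 : DifferentiableAt ℝ (fderiv ℝ ψ) y :=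
    (hψ.fderiv_right (m := 1) (by norm_num)).differentiableAt (by norm_num)
  have h2 : DifferentiableAt ℝ (fderiv ℝ W) y :=
    (hW.fderiv_right (m := 1) (by norm_num)).differentiableAt (by norm_num)
  have h3 : HasFDerivAt (fun y => Γ (ψ y)) _ y :=
    HasFDerivAt.comp (g := Γ) y hΓ.hasFDerivAt (hψ.differentiableAt (by norm_num)).hasFDerivAt
  have hW1 := (hW.differentiableAt (by norm_num)).hasFDerivAt
  have key : ∀ u v, covAlong Γ ψ u (covAlong Γ ψ v W) y =
      fderiv ℝ (fderiv ℝ W) y u v + fderiv ℝ Γ (ψ y) (fderiv ℝ ψ y u) (fderiv ℝ ψ y v) (W y) +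
      Γ (ψ y) (fderiv ℝ (fderiv ℝ ψ) y u v) (W y) + Γ (ψ y) (fderiv ℝ ψ y v) (fderiv ℝ W y u) +
      Γ (ψ y) (fderiv ℝ ψ y u) (fderiv ℝ W y v) +
      Γ (ψ y) (fderiv ℝ ψ y u) (Γ (ψ y) (fderiv ℝ ψ y v) (W y)) := by
    intro u v
    have e : HasFDerivAt (covAlong Γ ψ v W) _ y :=
      (h2.hasFDerivAt.clm_apply (hasFDerivAt_const v y)).add
        ((h3.clm_apply (h1.hasFDerivAt.clm_apply (hasFDerivAt_const v y))).clm_apply hW1)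
    rw [covAlong, e.fderiv]
    simp [covAlong]
    abel
  have hs1 : fderiv ℝ (fderiv ℝ W) y u v = fderiv ℝ (fderiv ℝ W) y v u :=
    hW.isSymmSndFDerivAt (by simp) u v
  have hs2 : fderiv ℝ (fderiv ℝ ψ) y u v = fderiv ℝ (fderiv ℝ ψ) y v u :=
    hψ.isSymmSndFDerivAt (by simp) u v
  rw [key u v, key v u, hs1, hs2, connectionCurvature]
  abel

lemma covAlong_coordinate_symm (hψ : ContDiffAt ℝ 2 ψ y)
    (hs : ∀ u v, Γ (ψ y) u v = Γ (ψ y) v u) (u v : F) :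
    covAlong Γ ψ u (fun y => fderiv ℝ ψ y v) y = covAlong Γ ψ v (fun y => fderiv ℝ ψ y u) y := by
  have h1 : DifferentiableAt ℝ (fderiv ℝ ψ) y :=
    (hψ.fderiv_right (m := 1) (by norm_num)).differentiableAt (by norm_num)
  have key : ∀ u v, fderiv ℝ (fun y => fderiv ℝ ψ y v) y u = fderiv ℝ (fderiv ℝ ψ) y u v := by
    intro u v
    have e : HasFDerivAt (fun y => fderiv ℝ ψ y v) _ y :=
      h1.hasFDerivAt.clm_apply (hasFDerivAt_const v y)
    rw [e.fderiv]; simp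
  have hs2 : fderiv ℝ (fderiv ℝ ψ) y u v = fderiv ℝ (fderiv ℝ ψ) y v u :=
    hψ.isSymmSndFDerivAt (by simp) u v
  rw [covAlong, covAlong, key, key, hs2, hs]

/-- The Koszul formula for coordinate fields. -/
lemma koszul_along (hG : DifferentiableAt ℝ G (ψ y)) (hψ : ContDiffAt ℝ 2 ψ y)
    (hgs : ∀ u v, G (ψ y) u v = G (ψ y) v u)
    (hs : ∀ u v, Γ (ψ y) u v = Γ (ψ y) v u)
    (hc : ∀ u a b, fderiv ℝ G (ψ y) u a b =
      G (ψ y) (Γ (ψ y) u a) b + G (ψ y) a (Γ (ψ y) u b)) (a b d : F) :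
    2 * G (ψ y) (covAlong Γ ψ a (fun y => fderiv ℝ ψ y b) y) (fderiv ℝ ψ y d) =
      fderiv ℝ (fun y => G (ψ y) (fderiv ℝ ψ y b) (fderiv ℝ ψ y d)) y a +
      fderiv ℝ (fun y => G (ψ y) (fderiv ℝ ψ y a) (fderiv ℝ ψ y d)) y b -
      fderiv ℝ (fun y => G (ψ y) (fderiv ℝ ψ y a) (fderiv ℝ ψ y b)) y d := by
  have h1 : DifferentiableAt ℝ (fderiv ℝ ψ) y :=
    (hψ.fderiv_right (m := 1) (by norm_num)).differentiableAt (by norm_num)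
  have hX : ∀ a, DifferentiableAt ℝ (fun y => fderiv ℝ ψ y a) y := fun a =>
    h1.clm_apply (differentiableAt_const a)
  have hψ1 : DifferentiableAt ℝ ψ y := hψ.differentiableAt (by norm_num)
  rw [fderiv_metric_along hG hψ1 hc (hX b) (hX d), fderiv_metric_along hG hψ1 hc (hX a) (hX d),
    fderiv_metric_along hG hψ1 hc (hX a) (hX b), covAlong_coordinate_symm hψ hs b a,
    covAlong_coordinate_symm hψ hs d a, covAlong_coordinate_symm hψ hs d b,
    hgs (covAlong Γ ψ a (fun y => fderiv ℝ ψ y d) y)]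
  ring

end Along

/-! ### Product metrics -/

lemma fderiv_eq_zero_of_eventually_const_along {F : Type*} [NormedAddCommGroup F] [NormedSpace ℝ F]
    {f : F → ℝ} {y d : F} (hf : DifferentiableAt ℝ f y)
    (h : ∀ᶠ t : ℝ in 𝓝 0, f (y + t • d) = f y) : fderiv ℝ f y d = 0 := by
  have h1 := hf.hasFDerivAt.hasLineDerivAt d
  have h2 : HasDerivAt (fun t : ℝ => f (y + t • d)) 0 0 :=
    (hasDerivAt_const (0 : ℝ) (f y)).congr_of_eventuallyEq h
  exact HasDerivAt.unique h1 h2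

lemma eventually_line {F : Type*} [NormedAddCommGroup F] [NormedSpace ℝ F] {p : F → Prop} {y : F}
    (h : ∀ᶠ x in 𝓝 y, p x) (d : F) : ∀ᶠ t : ℝ in 𝓝 0, p (y + t • d) := by
  have : Filter.Tendsto (fun t : ℝ => y + t • d) (𝓝 0) (𝓝 y) := by
    have : Continuous fun t : ℝ => y + t • d := by fun_prop
    simpa using this.tendsto 0
  exact this.eventually h

section Product

variable {E₁ E₂ : Type*} [NormedAddCommGroup E₁] [NormedSpace ℝ E₁] [NormedAddCommGroup E₂]
  [NormedSpace ℝ E₂]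

/-- In coordinates in which the metric is a product metric, the curvature preserves the tangent
spaces of the second factor. -/
lemma IsLeviCivitaAt.curvature_product_mixed {ψ : E₁ × E₂ → E} {x₀ : E₁ × E₂}
    (h : IsLeviCivitaAt G Γ (ψ x₀)) (hψ : ContDiffAt ℝ 3 ψ x₀)
    (hsurj : Function.Surjective (fderiv ℝ ψ x₀))
    {G₁ : E₁ → E₁ → E₁ → ℝ} {G₂ : E₂ → E₂ → E₂ → ℝ} (h₁₀ : ∀ y v, G₁ y 0 v = 0)
    (h₁₀' : ∀ y v, G₁ y v 0 = 0) (h₂₀ : ∀ y v, G₂ y 0 v = 0) (h₂₀' : ∀ y v, G₂ y v 0 = 0)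
    (h₂ : ∀ v, G₂ x₀.2 v v = 0 → v = 0)
    (hprod : ∀ᶠ y in 𝓝 x₀, ∀ u v, G (ψ y) (fderiv ℝ ψ y u) (fderiv ℝ ψ y v) =
      G₁ y.1 u.1 v.1 + G₂ y.2 u.2 v.2) (u v : E₁ × E₂) (w : E₁) (z : E₂) :
    G (ψ x₀) (connectionCurvature Γ (ψ x₀) (fderiv ℝ ψ x₀ u) (fderiv ℝ ψ x₀ v)
      (fderiv ℝ ψ x₀ (0, z))) (fderiv ℝ ψ x₀ (w, 0)) = 0 := by
  have hcont := hψ.continuousAt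
  have hψ2 : ∀ᶠ y in 𝓝 x₀, ContDiffAt ℝ 2 ψ y :=
    (hψ.of_le (by norm_num)).eventually (by simp)
  have hGd : ∀ᶠ y in 𝓝 x₀, DifferentiableAt ℝ G (ψ y) := by
    have := h.contDiffAt_metric.eventually (by simp)
    filter_upwards [hcont.eventually this] with y hy using hy.differentiableAt (by norm_num)
  have hgs := hcont.eventually h.metric_symm
  have hs := hcont.eventually h.torsion_free
  have hc := hcont.eventually h.compat
  have hX : ∀ y, ContDiffAt ℝ 2 ψ y → ∀ a, DifferentiableAt ℝ (fun y => fderiv ℝ ψ y a) y :=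
    fun y hy a => ((hy.fderiv_right (m := 1) (by norm_num)).differentiableAt
      (by norm_num)).clm_apply (differentiableAt_const a)
  have hH : ∀ y, ContDiffAt ℝ 2 ψ y → DifferentiableAt ℝ G (ψ y) → ∀ a b,
      DifferentiableAt ℝ (fun y => G (ψ y) (fderiv ℝ ψ y a) (fderiv ℝ ψ y b)) y :=
    fun y hy hGy a b => by
      have : DifferentiableAt ℝ (fun y => G (ψ y)) y :=
        DifferentiableAt.comp (g := G) y hGy (hy.differentiableAt (by norm_num))
      exact (this.clm_apply (hX y hy a)).clm_apply (hX y hy b)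
  -- Covariant derivatives of second-factor fields are orthogonal to the first factor. In the Koszul
  -- formula the mixed component is zero, and the component of `G₁` (respectively `G₂`) is constant
  -- in the direction of the other factor.
  have K1 : ∀ᶠ y in 𝓝 x₀, ∀ (a : E₁ × E₂) (w : E₁) (z : E₂),
      G (ψ y) (covAlong Γ ψ a (fun y => fderiv ℝ ψ y (0, z)) y) (fderiv ℝ ψ y (w, 0)) = 0 := by
    filter_upwards [hψ2, hGd, hgs, hs, hc, hprod.eventually_nhds] with y y1 y2 y3 y4 y5 y6 a w z
    have hk := koszul_along y2 y1 y3 y4 y5 a (0, z) (w, 0)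
    have e1 : fderiv ℝ (fun y => G (ψ y) (fderiv ℝ ψ y (0, z)) (fderiv ℝ ψ y (w, 0))) y a = 0 := by
      have : (fun y => G (ψ y) (fderiv ℝ ψ y (0, z)) (fderiv ℝ ψ y (w, 0))) =ᶠ[𝓝 y]
          fun _ => 0 := by
        filter_upwards [y6] with x hx
        rw [hx]; simp [h₁₀, h₂₀']
      rw [this.fderiv_eq]; simp
    have e2 : fderiv ℝ (fun y => G (ψ y) (fderiv ℝ ψ y a) (fderiv ℝ ψ y (w, 0))) y (0, z) = 0 := by
      refine fderiv_eq_zero_of_eventually_const_along (hH y y1 y2 _ _) ?_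
      filter_upwards [eventually_line y6 (0, z)] with t ht
      rw [ht, y6.self_of_nhds]; simp [h₂₀']
    have e3 : fderiv ℝ (fun y => G (ψ y) (fderiv ℝ ψ y a) (fderiv ℝ ψ y (0, z))) y (w, 0) = 0 := by
      refine fderiv_eq_zero_of_eventually_const_along (hH y y1 y2 _ _) ?_
      filter_upwards [eventually_line y6 (w, 0)] with t ht
      rw [ht, y6.self_of_nhds]; simp [h₁₀']
    rw [e1, e2, e3] at hk
    linarith
  have hψx := hψ2.self_of_nhds
  have hGx := hGd.self_of_nhds
  have hcx := hc.self_of_nhds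
  have hgsx := hgs.self_of_nhds
  have hψ1 : DifferentiableAt ℝ ψ x₀ := hψx.differentiableAt (by norm_num)
  have hΓ : DifferentiableAt ℝ Γ (ψ x₀) := h.contDiffAt_connection.differentiableAt (by norm_num)
  -- The mirror statement follows by differentiating the orthogonality of the two kinds of fields.
  have K2 : ∀ (a : E₁ × E₂) (w : E₁) (z : E₂), G (ψ x₀)
      (covAlong Γ ψ a (fun y => fderiv ℝ ψ y (w, 0)) x₀) (fderiv ℝ ψ x₀ (0, z)) = 0 := by
    intro a w z
    have e := fderiv_metric_along hGx hψ1 hcx (hX x₀ hψx (w, 0)) (hX x₀ hψx (0, z)) a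
    have e1 : (fun y => G (ψ y) (fderiv ℝ ψ y (w, 0)) (fderiv ℝ ψ y (0, z))) =ᶠ[𝓝 x₀]
        fun _ => 0 := by
      filter_upwards [hprod] with x hx
      rw [hx]; simp [h₁₀', h₂₀]
    rw [e1.fderiv_eq, hgsx (fderiv ℝ ψ x₀ (w, 0)), K1.self_of_nhds a w z] at e
    simpa using e.symm
  have hXc : ContDiffAt ℝ 2 (fun y => fderiv ℝ ψ y (0, z)) x₀ :=
    (hψ.fderiv_right (m := 2) (by norm_num)).clm_apply contDiffAt_const
  -- Differentiating the relation `K1` leaves the pairing of ∇_v Z with ∇_u W. By `K2` and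
  -- definiteness of `G₂`, ∇_u W is tangent to the first factor, so `K1` kills the pairing too.
  have hcov : ∀ u v : E₁ × E₂, G (ψ x₀)
      (covAlong Γ ψ u (covAlong Γ ψ v (fun y => fderiv ℝ ψ y (0, z))) x₀)
      (fderiv ℝ ψ x₀ (w, 0)) = 0 := by
    intro u v
    have e := fderiv_metric_along hGx hψ1 hcx
      (differentiableAt_covAlong hΓ hψx hXc v) (hX x₀ hψx (w, 0)) u
    have e1 : (fun y => G (ψ y) (covAlong Γ ψ v (fun y => fderiv ℝ ψ y (0, z)) y)
        (fderiv ℝ ψ y (w, 0))) =ᶠ[𝓝 x₀] fun _ => 0 := by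
      filter_upwards [K1] with y hy using hy v w z
    rw [e1.fderiv_eq] at e
    obtain ⟨⟨q₁, q₂⟩, hq⟩ := hsurj (covAlong Γ ψ u (fun y => fderiv ℝ ψ y (w, 0)) x₀)
    have hq2 : q₂ = 0 := by
      have := K2 u w q₂
      rw [← hq, hprod.self_of_nhds] at this
      exact h₂ q₂ (by simpa [h₁₀'] using this)
    rw [← hq, hq2, K1.self_of_nhds v q₁ z] at e
    simpa using e.symm
  have hcomm := covAlong_commutator hΓ hψx hXc u v
  rw [← hcomm, map_sub, sub_apply, hcov, hcov, sub_zero]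

end Product

end Connection

/-! ### The Levi-Civita connection in coordinates -/

section Coordinates

lemma contDiffAt_det {X : Type*} [NormedAddCommGroup X] [NormedSpace ℝ X] {n : ℕ} {r : WithTop ℕ∞}
    {A : X → Matrix (Fin n) (Fin n) ℝ} {c : X} (hA : ∀ i j, ContDiffAt ℝ r (fun x => A x i j) c) :
    ContDiffAt ℝ r (fun x => (A x).det) c := by
  simp only [Matrix.det_apply]
  refine ContDiffAt.sum fun σ _ => ContDiffAt.const_smul _ ?_
  exact contDiffAt_prod fun i _ => hA _ _

/-- Cramer's rule writes each entry as a quotient of determinants, which are polynomial in the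
entries of `A`. -/
lemma contDiffAt_matrix_inv {X : Type*} [NormedAddCommGroup X] [NormedSpace ℝ X] {n : ℕ}
    {r : WithTop ℕ∞} {A : X → Matrix (Fin n) (Fin n) ℝ} {c : X}
    (hA : ∀ i j, ContDiffAt ℝ r (fun x => A x i j) c) (hdet : (A c).det ≠ 0) (k l : Fin n) :
    ContDiffAt ℝ r (fun x => (A x)⁻¹ k l) c := by
  have h1 : (fun x => (A x)⁻¹ k l) =
      fun x => ((A x).det)⁻¹ * ((A x).updateRow l (Pi.single k 1)).det := by
    funext x
    rw [Matrix.inv_def, Ring.inverse_eq_inv', Matrix.smul_apply, Matrix.adjugate_apply, smul_eq_mul]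
  rw [h1]
  refine ((contDiffAt_det hA).inv hdet).mul (contDiffAt_det fun i j => ?_)
  by_cases h : i = l
  · subst h
    simpa using contDiffAt_const
  · simpa [Matrix.updateRow_ne h] using hA i j

variable {n : ℕ}

local notation "𝔼" => EuclideanSpace ℝ (Fin n)

lemma sum_coord_smul_single (u : 𝔼) : ∑ i, u i • EuclideanSpace.single i (1 : ℝ) = u := by
  have := (EuclideanSpace.basisFun (Fin n) ℝ).sum_repr u
  simpa using this

/-- The continuous bilinear map with prescribed values on the standard basis. -/
def bilinOfCoord {W : Type*} [NormedAddCommGroup W] [NormedSpace ℝ W] (f : Fin n → Fin n → W) :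
    𝔼 →L[ℝ] 𝔼 →L[ℝ] W :=
  ∑ i, ∑ j, (EuclideanSpace.proj i : 𝔼 →L[ℝ] ℝ).smulRight
    ((EuclideanSpace.proj j : 𝔼 →L[ℝ] ℝ).smulRight (f i j))

lemma bilinOfCoord_apply {W : Type*} [NormedAddCommGroup W] [NormedSpace ℝ W]
    (f : Fin n → Fin n → W) (u v : 𝔼) : bilinOfCoord f u v = ∑ i, ∑ j, u i • v j • f i j := by
  simp [bilinOfCoord]

lemma bilinOfCoord_eq {W : Type*} [NormedAddCommGroup W] [NormedSpace ℝ W]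
    (B : 𝔼 →ₗ[ℝ] 𝔼 →ₗ[ℝ] W) (u v : 𝔼) :
    bilinOfCoord (fun i j => B (EuclideanSpace.single i 1) (EuclideanSpace.single j 1)) u v =
      B u v := by
  rw [bilinOfCoord_apply]
  conv_rhs => rw [← sum_coord_smul_single u, ← sum_coord_smul_single v]
  simp only [map_sum, map_smul, LinearMap.sum_apply, LinearMap.smul_apply, Finset.smul_sum]
  rw [Finset.sum_comm]
  exact Finset.sum_congr rfl fun i _ => Finset.sum_congr rfl fun j _ => smul_comm _ _ _

lemma contDiffAt_bilinOfCoord {W : Type*} [NormedAddCommGroup W] [NormedSpace ℝ W]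
    {X : Type*} [NormedAddCommGroup X] [NormedSpace ℝ X] {r : WithTop ℕ∞}
    {f : X → Fin n → Fin n → W} {c : X} (hf : ∀ i j, ContDiffAt ℝ r (fun x => f x i j) c) :
    ContDiffAt ℝ r (fun x => (bilinOfCoord (f x) : 𝔼 →L[ℝ] 𝔼 →L[ℝ] W)) c := by
  unfold bilinOfCoord
  exact ContDiffAt.sum fun i _ => ContDiffAt.sum fun j _ =>
    contDiffAt_const.smulRight (contDiffAt_const.smulRight (hf i j))

/-- The Christoffel symbols of the first kind of `G`, in terms of the derivative `D` of `G`. -/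
def christoffelOfDeriv (D : 𝔼 →L[ℝ] 𝔼 →L[ℝ] 𝔼 →L[ℝ] ℝ) (u v w : 𝔼) : ℝ :=
  (1 / 2) * (D u v w + D v u w - D w u v)

/-- The Christoffel symbols of the second kind, in terms of the derivative `D` of the metric and the
inverse of its Gram matrix. -/
def raisedChristoffel (A : Matrix (Fin n) (Fin n) ℝ) (D : 𝔼 →L[ℝ] 𝔼 →L[ℝ] 𝔼 →L[ℝ] ℝ) :
    𝔼 →ₗ[ℝ] 𝔼 →ₗ[ℝ] 𝔼 :=
  LinearMap.mk₂ ℝ (fun u v => ∑ k, (∑ l, A k l * christoffelOfDeriv D u v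
      (EuclideanSpace.single l 1)) • EuclideanSpace.single k (1 : ℝ))
    (fun u u' v => by
      rw [← Finset.sum_add_distrib]
      refine Finset.sum_congr rfl fun k _ => ?_
      rw [← add_smul, ← Finset.sum_add_distrib]
      congr 1
      refine Finset.sum_congr rfl fun l _ => ?_
      simp only [christoffelOfDeriv, map_add, add_apply]
      ring)
    (fun r u v => by
      rw [Finset.smul_sum]
      refine Finset.sum_congr rfl fun k _ => ?_
      rw [smul_smul, Finset.mul_sum]
      congr 1
      refine Finset.sum_congr rfl fun l _ => ?_
      simp only [christoffelOfDeriv, map_smul, smul_apply, smul_eq_mul]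
      ring)
    (fun u v v' => by
      rw [← Finset.sum_add_distrib]
      refine Finset.sum_congr rfl fun k _ => ?_
      rw [← add_smul, ← Finset.sum_add_distrib]
      congr 1
      refine Finset.sum_congr rfl fun l _ => ?_
      simp only [christoffelOfDeriv, map_add, add_apply]
      ring)
    (fun r u v => by
      rw [Finset.smul_sum]
      refine Finset.sum_congr rfl fun k _ => ?_
      rw [smul_smul, Finset.mul_sum]
      congr 1
      refine Finset.sum_congr rfl fun l _ => ?_
      simp only [christoffelOfDeriv, map_smul, smul_apply, smul_eq_mul]
      ring)

lemma raisedChristoffel_apply (A : Matrix (Fin n) (Fin n) ℝ)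
    (D : 𝔼 →L[ℝ] 𝔼 →L[ℝ] 𝔼 →L[ℝ] ℝ) (u v : 𝔼) :
    raisedChristoffel A D u v = ∑ k, (∑ l, A k l * christoffelOfDeriv D u v
      (EuclideanSpace.single l 1)) • EuclideanSpace.single k (1 : ℝ) := rfl

/-- A kernel vector of the Gram matrix would have zero length, against positivity. Lowering the
index with `H` then undoes the multiplication by the inverse matrix. -/
lemma metric_raisedChristoffel {H : 𝔼 →L[ℝ] 𝔼 →L[ℝ] ℝ} (hsymm : ∀ u v, H u v = H v u)
    (hpos : ∀ u, u ≠ 0 → 0 < H u u) (D : 𝔼 →L[ℝ] 𝔼 →L[ℝ] 𝔼 →L[ℝ] ℝ)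
    {A : Matrix (Fin n) (Fin n) ℝ}
    (hA : A = Matrix.of fun i j => H (EuclideanSpace.single i 1) (EuclideanSpace.single j 1)) :
    A.det ≠ 0 ∧ ∀ u v w, H (raisedChristoffel A⁻¹ D u v) w = christoffelOfDeriv D u v w := by
  have hdet : A.det ≠ 0 := by
    intro h0
    obtain ⟨x, hx0, hx⟩ := Matrix.exists_mulVec_eq_zero_iff.2 h0
    set u : 𝔼 := ∑ i, x i • EuclideanSpace.single i (1 : ℝ) with hu
    have hux : ∀ i, u i = x i := by
      intro i
      simp [hu, Pi.single_apply]
    have hu0 : u ≠ 0 := by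
      intro h
      apply hx0
      funext i
      rw [← hux i, h]; rfl
    have := hpos u hu0
    have h1 : H u u = ∑ i, x i * (A.mulVec x) i := by
      simp only [Matrix.mulVec, dotProduct, hA, Matrix.of_apply, Finset.mul_sum]
      simp only [hu, map_sum, map_smul, sum_apply, smul_apply, smul_eq_mul,
        Finset.mul_sum]
      rw [Finset.sum_comm]
      exact Finset.sum_congr rfl fun i _ => Finset.sum_congr rfl fun j _ => by ring
    rw [h1, hx] at this
    simp at this
  refine ⟨hdet, fun u v w => ?_⟩
  have hlin : ∀ w : 𝔼, christoffelOfDeriv D u v w =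
      ∑ j, w j * christoffelOfDeriv D u v (EuclideanSpace.single j 1) := by
    intro w
    conv_lhs => rw [← sum_coord_smul_single w]
    simp only [christoffelOfDeriv, map_sum, map_smul, sum_apply, smul_apply,
      smul_eq_mul, ← Finset.sum_add_distrib, ← Finset.sum_sub_distrib, Finset.mul_sum]
    exact Finset.sum_congr rfl fun j _ => by ring
  have hbasis : ∀ j, H (raisedChristoffel A⁻¹ D u v) (EuclideanSpace.single j 1) =
      christoffelOfDeriv D u v (EuclideanSpace.single j 1) := by
    intro j
    rw [raisedChristoffel_apply]
    simp only [map_sum, map_smul, sum_apply, smul_apply, smul_eq_mul]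
    have h1 : ∀ k, H (EuclideanSpace.single k 1) (EuclideanSpace.single j 1) = A j k := by
      intro k; rw [hsymm, hA]; rfl
    simp only [h1, Finset.sum_mul]
    rw [Finset.sum_comm]
    have h2 : ∀ l, ∑ k, A⁻¹ k l * christoffelOfDeriv D u v (EuclideanSpace.single l 1) * A j k =
        (if j = l then 1 else 0) * christoffelOfDeriv D u v (EuclideanSpace.single l 1) := by
      intro l
      rw [← Matrix.one_apply, ← Matrix.mul_nonsing_inv A (isUnit_iff_ne_zero.2 hdet),
        Matrix.mul_apply, Finset.sum_mul]
      exact Finset.sum_congr rfl fun k _ => by ring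
    simp [h2]
  rw [hlin w]
  conv_lhs => rw [← sum_coord_smul_single w]
  simp [hbasis]

/-- A smooth metric in coordinates has a Levi-Civita connection, whose curvature is given by the
classical formula in terms of Christoffel symbols. -/
lemma exists_isLeviCivitaAt (B : 𝔼 → LinearMap.BilinForm ℝ 𝔼) {c : 𝔼}
    (hsmooth : ∀ u v, ContDiffAt ℝ 2 (fun x => B x u v) c) (hsymm : ∀ x u v, B x u v = B x v u)
    (hpos : ∀ᶠ x in 𝓝 c, ∀ u, u ≠ 0 → 0 < B x u u) :
    ∃ (G : 𝔼 → 𝔼 →L[ℝ] 𝔼 →L[ℝ] ℝ) (Γ : 𝔼 → 𝔼 →L[ℝ] 𝔼 →L[ℝ] 𝔼), (∀ x u v, G x u v = B x u v) ∧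
      IsLeviCivitaAt G Γ c ∧ ∀ u v w, coordCurvature (fun x u v => B x u v) c u v w =
        connectionCurvature Γ c u v w := by
  set G : 𝔼 → 𝔼 →L[ℝ] 𝔼 →L[ℝ] ℝ := fun x => bilinOfCoord fun i j =>
    B x (EuclideanSpace.single i 1) (EuclideanSpace.single j 1) with hGdef
  have hGB : ∀ x u v, G x u v = B x u v := fun x u v => bilinOfCoord_eq (B x) u v
  have hG : ContDiffAt ℝ 2 G c := contDiffAt_bilinOfCoord fun i j => hsmooth _ _
  set A : 𝔼 → Matrix (Fin n) (Fin n) ℝ := gramMatrix fun x u v => B x u v with hAdef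
  have hAG : ∀ x, A x =
      Matrix.of fun i j => G x (EuclideanSpace.single i 1) (EuclideanSpace.single j 1) := by
    intro x; ext i j; simp [hAdef, gramMatrix, hGB]
  have hGs : ∀ x u v, G x u v = G x v u := fun x u v => by rw [hGB, hGB, hsymm]
  have hraise : ∀ᶠ x in 𝓝 c, (A x).det ≠ 0 ∧ ∀ u v w,
      G x (raisedChristoffel (A x)⁻¹ (fderiv ℝ G x) u v) w =
        christoffelOfDeriv (fderiv ℝ G x) u v w := by
    filter_upwards [hpos] with x hx
    exact metric_raisedChristoffel (hGs x) (fun u hu => by rw [hGB]; exact hx u hu) _ (hAG x)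
  have hGd : ∀ᶠ x in 𝓝 c, DifferentiableAt ℝ G x := by
    filter_upwards [hG.eventually (by simp)] with x hx using hx.differentiableAt (by norm_num)
  have hDapply : ∀ᶠ x in 𝓝 c, ∀ u v w, fderiv ℝ (fun y => B y v w) x u = fderiv ℝ G x u v w := by
    filter_upwards [hGd] with x hx u v w
    have e : HasFDerivAt (fun y => G y v w) _ x :=
      (hx.hasFDerivAt.clm_apply (hasFDerivAt_const v x)).clm_apply (hasFDerivAt_const w x)
    have e1 : (fun y => B y v w) = fun y => G y v w := by funext y; rw [hGB]
    rw [e1, e.fderiv]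
    simp
  set Γ : 𝔼 → 𝔼 →L[ℝ] 𝔼 →L[ℝ] 𝔼 := fun x => bilinOfCoord fun i j =>
    raisedChristoffel (A x)⁻¹ (fderiv ℝ G x) (EuclideanSpace.single i 1)
      (EuclideanSpace.single j 1) with hΓdef
  have hΓ : ∀ x u v, Γ x u v = raisedChristoffel (A x)⁻¹ (fderiv ℝ G x) u v :=
    fun x u v => bilinOfCoord_eq _ u v
  have hchr : ∀ᶠ x in 𝓝 c, ∀ u v, christoffel (fun x u v => B x u v) x u v = Γ x u v := by
    filter_upwards [hDapply] with x hx u v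
    rw [hΓ, raisedChristoffel_apply, christoffel]
    simp only [christoffelFirst, christoffelOfDeriv, hx]
    rfl
  have hDsymm : ∀ᶠ x in 𝓝 c, ∀ u v w, fderiv ℝ G x u v w = fderiv ℝ G x u w v := by
    filter_upwards [hDapply] with x hx u v w
    rw [← hx, ← hx]
    simp only [hsymm _ v w]
  have hΓc : ContDiffAt ℝ 1 Γ c := by
    refine contDiffAt_bilinOfCoord fun i j => ?_
    simp only [raisedChristoffel_apply]
    refine ContDiffAt.sum fun k _ => ContDiffAt.fun_smul (ContDiffAt.sum fun l _ => ?_)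
      contDiffAt_const
    refine ContDiffAt.mul ?_ ?_
    · refine contDiffAt_matrix_inv (fun p q => ?_) hraise.self_of_nhds.1 k l
      exact (hsmooth _ _).of_le (by norm_num)
    · have hD : ∀ u v w, ContDiffAt ℝ 1 (fun x => fderiv ℝ G x u v w) c := fun u v w =>
        (((hG.fderiv_right (m := 1) (by norm_num)).clm_apply contDiffAt_const).clm_apply
          contDiffAt_const).clm_apply contDiffAt_const
      exact contDiffAt_const.mul (((hD _ _ _).add (hD _ _ _)).sub (hD _ _ _))
  refine ⟨G, Γ, hGB, ⟨hG, hΓc, Filter.Eventually.of_forall hGs, ?_, ?_⟩, fun u v w => ?_⟩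
  · filter_upwards [hDsymm] with x hx u v
    rw [hΓ, hΓ, raisedChristoffel_apply, raisedChristoffel_apply]
    simp only [christoffelOfDeriv, hx _ u v, add_comm (fderiv ℝ G x u v _)]
  -- In the sum of the two lowered Christoffel symbols everything cancels except the derivative of
  -- g(a,b) along u.
  · filter_upwards [hraise, hDsymm] with x hx hxs u a b
    rw [hGs x a, hΓ, hΓ, hx.2, hx.2, christoffelOfDeriv, christoffelOfDeriv, hxs u b a, hxs a u b,
      hxs b u a]
    ring
  · have hΓd : DifferentiableAt ℝ Γ c := hΓc.differentiableAt (by norm_num)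
    have e : ∀ a b d, fderiv ℝ (fun y => christoffel (fun x u v => B x u v) y a b) c d =
        fderiv ℝ Γ c d a b := by
      intro a b d
      have e1 : (fun y => christoffel (fun x u v => B x u v) y a b) =ᶠ[𝓝 c] fun y => Γ y a b := by
        filter_upwards [hchr] with x hx using hx a b
      have e2 : HasFDerivAt (fun y => Γ y a b) _ c :=
        (hΓd.hasFDerivAt.clm_apply (hasFDerivAt_const a c)).clm_apply (hasFDerivAt_const b c)
      rw [e1.fderiv_eq, e2.fderiv]
      simp
    simp only [coordCurvature, connectionCurvature, e, hchr.self_of_nhds]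

end Coordinates

/-! ### Pullbacks of a Riemannian metric -/

section Pullback

variable {n : ℕ} {M : Type*} [TopologicalSpace M] [ChartedSpace (EuclideanSpace ℝ (Fin n)) M]
  [IsManifold (𝓡 n) ∞ M]

/-- The pullback of `g` by `f : N → M`, at `x`. -/
def pullbackMetric {F H N : Type*} [NormedAddCommGroup F] [NormedSpace ℝ F] [TopologicalSpace H]
    (I : ModelWithCorners ℝ F H) [TopologicalSpace N] [ChartedSpace H N]
    (g : SmoothMetric n M) (f : N → M) (x : N) (u v : TangentSpace I x) : ℝ :=
  g.inner (f x) (mfderiv I (𝓡 n) f x u) (mfderiv I (𝓡 n) f x v)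

section

variable {F H N : Type*} [NormedAddCommGroup F] [NormedSpace ℝ F] [TopologicalSpace H]
  {I : ModelWithCorners ℝ F H} [TopologicalSpace N] [ChartedSpace H N]
  (g : SmoothMetric n M) (f : N → M) (x : N)

lemma pullbackMetric_add_left (u u' v : TangentSpace I x) : pullbackMetric I g f x (u + u') v =
    pullbackMetric I g f x u v + pullbackMetric I g f x u' v := by
  simp [pullbackMetric]

lemma pullbackMetric_add_right (u v v' : TangentSpace I x) : pullbackMetric I g f x u (v + v') =
    pullbackMetric I g f x u v + pullbackMetric I g f x u v' := by
  simp [pullbackMetric]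

lemma pullbackMetric_smul_left (c : ℝ) (u v : TangentSpace I x) :
    pullbackMetric I g f x (c • u) v = c * pullbackMetric I g f x u v := by
  simp [pullbackMetric]

lemma pullbackMetric_smul_right (c : ℝ) (u v : TangentSpace I x) :
    pullbackMetric I g f x u (c • v) = c * pullbackMetric I g f x u v := by
  simp [pullbackMetric]

end

lemma pullbackMetric_congr {F H N : Type*} [NormedAddCommGroup F] [NormedSpace ℝ F]
    [TopologicalSpace H] {I : ModelWithCorners ℝ F H} [TopologicalSpace N] [ChartedSpace H N]
    (g : SmoothMetric n M) {f f' : N → M} {x : N} (h : f =ᶠ[𝓝 x] f') (u v : TangentSpace I x) :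
    pullbackMetric I g f x u v = pullbackMetric I g f' x u v := by
  have h1 : f x = f' x := h.self_of_nhds
  have h2 : (mfderiv I (𝓡 n) f x : F →L[ℝ] EuclideanSpace ℝ (Fin n)) =
    (mfderiv I (𝓡 n) f' x : F →L[ℝ] EuclideanSpace ℝ (Fin n)) := h.mfderiv_eq
  -- The type of the derivative depends on the base point; treating both as independent arguments of
  -- one function allows rewriting them separately.
  let K : M → (F →L[ℝ] EuclideanSpace ℝ (Fin n)) → ℝ := fun q L =>
    g.inner q (show TangentSpace (𝓡 n) q from L u) (show TangentSpace (𝓡 n) q from L v)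
  change K (f x) (mfderiv I (𝓡 n) f x) = K (f' x) (mfderiv I (𝓡 n) f' x)
  rw [h1, h2]

lemma pullbackMetric_comp {F H N F' H' N' : Type*} [NormedAddCommGroup F] [NormedSpace ℝ F]
    [TopologicalSpace H] {I : ModelWithCorners ℝ F H} [TopologicalSpace N] [ChartedSpace H N]
    [NormedAddCommGroup F'] [NormedSpace ℝ F'] [TopologicalSpace H'] {I' : ModelWithCorners ℝ F' H'}
    [TopologicalSpace N'] [ChartedSpace H' N']
    (g : SmoothMetric n M) {f : N → M} {h : N' → N} {x : N'}
    (hf : MDifferentiableAt I (𝓡 n) f (h x)) (hh : MDifferentiableAt I' I h x)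
    (u v : TangentSpace I' x) :
    pullbackMetric I' g (f ∘ h) x u v =
      pullbackMetric I g f (h x) (mfderiv I' I h x u) (mfderiv I' I h x v) := by
  unfold pullbackMetric
  rw [mfderiv_comp x hf hh]
  rfl

/-! ### The metric in a chart -/

lemma metricInChart_eq_pullbackMetric (g : SmoothMetric n M) (p : M)
    (x u v : EuclideanSpace ℝ (Fin n)) : metricInChart g p x u v =
      pullbackMetric 𝓘(ℝ, EuclideanSpace ℝ (Fin n)) g (extChartAt (𝓡 n) p).symm x u v := rfl

lemma contMDiffAt_extChartAt_symm_of_mem (p : M) {x : EuclideanSpace ℝ (Fin n)}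
    (hx : x ∈ (extChartAt (𝓡 n) p).target) :
    ContMDiffAt 𝓘(ℝ, EuclideanSpace ℝ (Fin n)) (𝓡 n) ∞ (extChartAt (𝓡 n) p).symm x :=
  (contMDiffOn_extChartAt_symm p).contMDiffAt ((isOpen_extChartAt_target p).mem_nhds hx)

lemma injective_mfderiv_extChartAt_symm (p : M) {x : EuclideanSpace ℝ (Fin n)}
    (hx : x ∈ (extChartAt (𝓡 n) p).target) {u : EuclideanSpace ℝ (Fin n)}
    (hu : mfderiv 𝓘(ℝ, EuclideanSpace ℝ (Fin n)) (𝓡 n) (extChartAt (𝓡 n) p).symm x u = 0) :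
    u = 0 := by
  have h := isInvertible_mfderivWithin_extChartAt_symm (I := 𝓡 n) hx
  simp only [modelWithCornersSelf_coe, Set.range_id, mfderivWithin_univ] at h
  exact h.injective (hu.trans (map_zero _).symm)

lemma metricInChart_pos (g : SmoothMetric n M) (p : M) {x : EuclideanSpace ℝ (Fin n)}
    (hx : x ∈ (extChartAt (𝓡 n) p).target) {u : EuclideanSpace ℝ (Fin n)} (hu : u ≠ 0) :
    0 < metricInChart g p x u u :=
  g.pos _ _ fun h => hu (injective_mfderiv_extChartAt_symm p hx h)

/-- `metricInChart` as a bilinear form. -/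
def chartForm (g : SmoothMetric n M) (p : M) (x : EuclideanSpace ℝ (Fin n)) :
    LinearMap.BilinForm ℝ (EuclideanSpace ℝ (Fin n)) :=
  LinearMap.mk₂ ℝ (metricInChart g p x) (fun u u' v => pullbackMetric_add_left g _ x u u' v)
    (fun c u v => pullbackMetric_smul_left g _ x c u v)
    (fun u v v' => pullbackMetric_add_right g _ x u v v')
    (fun c u v => pullbackMetric_smul_right g _ x c u v)

/-- The coordinate fields are smooth sections along the inverse chart, obtained from its tangent
map; pairing them with the smooth section `g.inner` gives a smooth function. -/
lemma contDiffAt_metricInChart (g : SmoothMetric n M) (p : M) {x : EuclideanSpace ℝ (Fin n)}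
    (hx : x ∈ (extChartAt (𝓡 n) p).target) (u v : EuclideanSpace ℝ (Fin n)) :
    ContDiffAt ℝ ∞ (fun x => metricInChart g p x u v) x := by
  set I₀ := 𝓘(ℝ, EuclideanSpace ℝ (Fin n))
  have hopen := isOpen_extChartAt_target (I := 𝓡 n) p
  have hsec : ∀ u : EuclideanSpace ℝ (Fin n), ContMDiffAt I₀ (𝓡 n).tangent ∞
      (fun y => (Bundle.TotalSpace.mk' (EuclideanSpace ℝ (Fin n))
        ((extChartAt (𝓡 n) p).symm y) (mfderiv I₀ (𝓡 n) (extChartAt (𝓡 n) p).symm y u) :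
          TangentBundle (𝓡 n) M)) x := by
    intro u
    have h1 : ContMDiffOn I₀.tangent (𝓡 n).tangent ∞
        (tangentMapWithin I₀ (𝓡 n) (extChartAt (𝓡 n) p).symm (extChartAt (𝓡 n) p).target) _ :=
      (contMDiffOn_extChartAt_symm (n := ∞) p).contMDiffOn_tangentMapWithin (by simp)
        hopen.uniqueMDiffOn
    have h2 : ContMDiffAt I₀ I₀.tangent ∞ (fun y => (⟨y, u⟩ :
        TangentBundle I₀ (EuclideanSpace ℝ (Fin n)))) x :=
      contMDiffAt_vectorSpace_iff_contDiffAt.2 contDiffAt_const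
    have h3 : ContMDiffAt I₀ (𝓡 n).tangent ∞ (fun y => tangentMapWithin I₀ (𝓡 n)
        (extChartAt (𝓡 n) p).symm (extChartAt (𝓡 n) p).target (⟨y, u⟩ :
          TangentBundle I₀ (EuclideanSpace ℝ (Fin n)))) x := by
      have h4 := (h1 (⟨x, u⟩ : TangentBundle I₀ (EuclideanSpace ℝ (Fin n))) hx).comp_of_eq
        (x := x) (s := (extChartAt (𝓡 n) p).target) h2.contMDiffWithinAt (fun y hy => hy) rfl
      exact h4.contMDiffAt (hopen.mem_nhds hx)
    refine h3.congr_of_eventuallyEq ?_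
    filter_upwards [hopen.mem_nhds hx] with y hy
    simp only [tangentMapWithin, mfderivWithin_of_isOpen hopen hy]
  have hg : ContMDiffAt I₀ ((𝓡 n).prod 𝓘(ℝ, EuclideanSpace ℝ (Fin n) →L[ℝ]
      EuclideanSpace ℝ (Fin n) →L[ℝ] ℝ)) ∞ (fun y => Bundle.TotalSpace.mk'
        (EuclideanSpace ℝ (Fin n) →L[ℝ] EuclideanSpace ℝ (Fin n) →L[ℝ] ℝ)
        (E := fun q : M => TangentSpace (𝓡 n) q →L[ℝ] TangentSpace (𝓡 n) q →L[ℝ] ℝ)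
        ((extChartAt (𝓡 n) p).symm y) (g.inner ((extChartAt (𝓡 n) p).symm y))) x :=
    (g.contMDiff.contMDiffAt (x := (extChartAt (𝓡 n) p).symm x)).comp x
      (contMDiffAt_extChartAt_symm_of_mem p hx)
  have hmain : ContMDiffAt I₀ ((𝓡 n).prod 𝓘(ℝ, ℝ)) ∞ (fun y => Bundle.TotalSpace.mk' ℝ
      (E := Bundle.Trivial M ℝ) ((extChartAt (𝓡 n) p).symm y) (metricInChart g p y u v)) x :=
    ContMDiffAt.clm_bundle_apply₂ (F₁ := EuclideanSpace ℝ (Fin n))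
      (F₂ := EuclideanSpace ℝ (Fin n)) hg (hsec u) (hsec v)
  rw [Bundle.contMDiffAt_totalSpace] at hmain
  exact hmain.2.contDiffAt

lemma exists_leviCivita_chart (g : SmoothMetric n M) (p : M) :
    ∃ (G : EuclideanSpace ℝ (Fin n) → EuclideanSpace ℝ (Fin n) →L[ℝ]
        EuclideanSpace ℝ (Fin n) →L[ℝ] ℝ)
      (Γ : EuclideanSpace ℝ (Fin n) → EuclideanSpace ℝ (Fin n) →L[ℝ]
        EuclideanSpace ℝ (Fin n) →L[ℝ] EuclideanSpace ℝ (Fin n)),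
      (∀ x u v, G x u v = metricInChart g p x u v) ∧
      IsLeviCivitaAt G Γ (extChartAt (𝓡 n) p p) ∧
      ∀ u v w z, riemannTensor g p u v w z = G (extChartAt (𝓡 n) p p)
        (connectionCurvature Γ (extChartAt (𝓡 n) p p) (toCoord p u) (toCoord p v) (toCoord p z))
        (toCoord p w) := by
  obtain ⟨G, Γ, hG, hΓ, hR⟩ := exists_isLeviCivitaAt (chartForm g p) (c := extChartAt (𝓡 n) p p)
    (fun u v => (contDiffAt_metricInChart g p (mem_extChartAt_target p) u v).of_le
      ENat.LEInfty.out) (fun x u v => g.symm _ _ _)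
    (by
      filter_upwards [(isOpen_extChartAt_target p).mem_nhds (mem_extChartAt_target p)]
        with x hx u hu
      exact metricInChart_pos g p hx hu)
  refine ⟨G, Γ, hG, hΓ, fun u v w z => ?_⟩
  rw [hG, ← hR]
  rfl

lemma toCoord_bijective (p : M) : Function.Bijective (toCoord (n := n) p) :=
  (isInvertible_mfderiv_extChartAt (I := 𝓡 n) (mem_extChartAt_source p)).bijective

/-- Chain rule for the inverse chart composed with the chart, which is the identity near `p`. -/
lemma metricInChart_toCoord (g : SmoothMetric n M) (p : M) (u v : TangentSpace (𝓡 n) p) :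
    metricInChart g p (extChartAt (𝓡 n) p p) (toCoord p u) (toCoord p v) = g.inner p u v := by
  have h1 : MDifferentiableAt (𝓡 n) 𝓘(ℝ, EuclideanSpace ℝ (Fin n)) (extChartAt (𝓡 n) p) p :=
    mdifferentiableAt_extChartAt (mem_chart_source _ p)
  have h2 := (contMDiffAt_extChartAt_symm_of_mem p
    (mem_extChartAt_target (I := 𝓡 n) p)).mdifferentiableAt (by simp)
  have h3 := pullbackMetric_comp g h2 h1 u v
  have h4 : (extChartAt (𝓡 n) p).symm ∘ extChartAt (𝓡 n) p =ᶠ[𝓝 p] id := by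
    filter_upwards [extChartAt_source_mem_nhds (I := 𝓡 n) p] with q hq
    exact (extChartAt (𝓡 n) p).left_inv hq
  rw [pullbackMetric_congr g h4] at h3
  rw [metricInChart_eq_pullbackMetric]
  refine h3.symm.trans ?_
  simp [pullbackMetric]

lemma isCurvatureLike_riemannTensor (g : SmoothMetric n M) (p : M) :
    IsCurvatureLike (riemannTensor g p) := by
  obtain ⟨G, Γ, hG, hΓ, hR⟩ := exists_leviCivita_chart g p
  have h := hΓ.isCurvatureLike
  have hadd : ∀ u v, toCoord (n := n) p (u + v) = toCoord p u + toCoord p v :=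
    fun u v => map_add _ u v
  have hsmul : ∀ (c : ℝ) u, toCoord (n := n) p (c • u) = c • toCoord p u :=
    fun c u => map_smul _ c u
  constructor
  · intro u u' v w z
    rw [hR, hR, hR, hadd]; exact h.add _ _ _ _ _
  · intro c u v w z
    rw [hR, hR, hsmul]; exact h.smul _ _ _ _ _
  · intro u v w z
    rw [hR, hR]; exact h.swap _ _ _ _
  · intro u v w z
    rw [hR, hR]; exact h.swap' _ _ _ _
  · intro u v w z
    rw [hR, hR, hR]; exact h.bianchi _ _ _ _

end Pullback

/-! ### Curvature of a Riemannian product -/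

section Product

variable {n k m : ℕ} {M : Type*} [TopologicalSpace M] [ChartedSpace (EuclideanSpace ℝ (Fin n)) M]
  [IsManifold (𝓡 n) ∞ M]
  {M₁ : Type*} [TopologicalSpace M₁] [ChartedSpace (EuclideanSpace ℝ (Fin k)) M₁]
  [IsManifold (𝓡 k) ∞ M₁]
  {M₂ : Type*} [TopologicalSpace M₂] [ChartedSpace (EuclideanSpace ℝ (Fin m)) M₂]
  [IsManifold (𝓡 m) ∞ M₂]

/-- The inverse of the product of the preferred charts around `x.1` and `x.2`. -/
def productChartSymm (x : M₁ × M₂) (y : EuclideanSpace ℝ (Fin k) × EuclideanSpace ℝ (Fin m)) :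
    M₁ × M₂ :=
  ((extChartAt (𝓡 k) x.1).symm y.1, (extChartAt (𝓡 m) x.2).symm y.2)

lemma contMDiffAt_productChartSymm (x : M₁ × M₂)
    {y : EuclideanSpace ℝ (Fin k) × EuclideanSpace ℝ (Fin m)}
    (hy₁ : y.1 ∈ (extChartAt (𝓡 k) x.1).target) (hy₂ : y.2 ∈ (extChartAt (𝓡 m) x.2).target) :
    ContMDiffAt 𝓘(ℝ, EuclideanSpace ℝ (Fin k) × EuclideanSpace ℝ (Fin m)) ((𝓡 k).prod (𝓡 m)) ∞
      (productChartSymm x) y :=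
  ((contMDiffAt_extChartAt_symm_of_mem x.1 hy₁).comp y
    contDiff_fst.contMDiff.contMDiffAt).prodMk
  ((contMDiffAt_extChartAt_symm_of_mem x.2 hy₂).comp y contDiff_snd.contMDiff.contMDiffAt)

/-- In product coordinates, the metric of a Riemannian product is the sum of the metrics of the
factors. -/
lemma pullbackMetric_product {g : SmoothMetric n M} {g₁ : SmoothMetric k M₁}
    {g₂ : SmoothMetric m M₂} {Φ : M₁ × M₂ → M} (hΦ : IsOpenIsometryFromProduct g g₁ g₂ Φ)
    (x : M₁ × M₂) {y : EuclideanSpace ℝ (Fin k) × EuclideanSpace ℝ (Fin m)}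
    (hy₁ : y.1 ∈ (extChartAt (𝓡 k) x.1).target) (hy₂ : y.2 ∈ (extChartAt (𝓡 m) x.2).target)
    (a b : EuclideanSpace ℝ (Fin k) × EuclideanSpace ℝ (Fin m)) :
    pullbackMetric 𝓘(ℝ, EuclideanSpace ℝ (Fin k) × EuclideanSpace ℝ (Fin m)) g
      (Φ ∘ productChartSymm x) y a b =
      metricInChart g₁ x.1 y.1 a.1 b.1 + metricInChart g₂ x.2 y.2 a.2 b.2 := by
  set I := 𝓘(ℝ, EuclideanSpace ℝ (Fin k) × EuclideanSpace ℝ (Fin m))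
  have hχ : MDifferentiableAt I ((𝓡 k).prod (𝓡 m)) (productChartSymm x) y :=
    (contMDiffAt_productChartSymm x hy₁ hy₂).mdifferentiableAt (by simp)
  have hΦd : MDifferentiableAt ((𝓡 k).prod (𝓡 m)) (𝓡 n) Φ (productChartSymm x y) :=
    hΦ.2.1.mdifferentiable (by simp) _
  refine (pullbackMetric_comp g hΦd hχ a b).trans ?_
  refine (hΦ.2.2 (productChartSymm x y) _ _).trans ?_
  have hd₁ : MDifferentiableAt 𝓘(ℝ, EuclideanSpace ℝ (Fin k)) (𝓡 k) (extChartAt (𝓡 k) x.1).symm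
      y.1 := (contMDiffAt_extChartAt_symm_of_mem x.1 hy₁).mdifferentiableAt (by simp)
  have hd₂ : MDifferentiableAt 𝓘(ℝ, EuclideanSpace ℝ (Fin m)) (𝓡 m) (extChartAt (𝓡 m) x.2).symm
      y.2 := (contMDiffAt_extChartAt_symm_of_mem x.2 hy₂).mdifferentiableAt (by simp)
  have hf₁ : MDifferentiableAt I 𝓘(ℝ, EuclideanSpace ℝ (Fin k)) Prod.fst y :=
    differentiableAt_fst.mdifferentiableAt
  have hf₂ : MDifferentiableAt I 𝓘(ℝ, EuclideanSpace ℝ (Fin m)) Prod.snd y :=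
    differentiableAt_snd.mdifferentiableAt
  -- This map is also the inverse chart of the first factor composed with the projection; the chain
  -- rule for the two descriptions compares the metrics.
  have e₁ : pullbackMetric I g₁ (Prod.fst ∘ productChartSymm x) y a b =
      metricInChart g₁ x.1 y.1 a.1 b.1 := by
    have := pullbackMetric_comp g₁ hd₁ hf₁ a b
    rw [mfderiv_eq_fderiv, fderiv_fst] at this
    exact this
  have e₂ : pullbackMetric I g₂ (Prod.snd ∘ productChartSymm x) y a b =
      metricInChart g₂ x.2 y.2 a.2 b.2 := by
    have := pullbackMetric_comp g₂ hd₂ hf₂ a b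
    rw [mfderiv_eq_fderiv, fderiv_snd] at this
    exact this
  have e₁' := pullbackMetric_comp g₁ (mdifferentiableAt_fst (I := 𝓡 k) (I' := 𝓡 m)
    (x := productChartSymm x y)) hχ a b
  have e₂' := pullbackMetric_comp g₂ (mdifferentiableAt_snd (I := 𝓡 k) (I' := 𝓡 m)
    (x := productChartSymm x y)) hχ a b
  rw [← e₁, ← e₂, e₁', e₂']
  rfl

/-- At each point of the image of a product, the tangent space is the orthogonal sum of the tangent
spaces of the factors, and the curvature tensor respects this decomposition. -/
lemma exists_curvature_splitting {g : SmoothMetric n M} {g₁ : SmoothMetric k M₁}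
    {g₂ : SmoothMetric m M₂} {Φ : M₁ × M₂ → M} (hn : k + m = n)
    (hΦ : IsOpenIsometryFromProduct g g₁ g₂ Φ) (x : M₁ × M₂) :
    ∃ W₁ W₂ : Submodule ℝ (TangentSpace (𝓡 n) (Φ x)), W₁ ⊔ W₂ = ⊤ ∧ Module.finrank ℝ W₁ = k ∧
      Module.finrank ℝ W₂ = m ∧ (∀ a ∈ W₁, ∀ b ∈ W₂, g.inner (Φ x) a b = 0) ∧
      ∀ u v, ∀ w ∈ W₁, ∀ z ∈ W₂, riemannTensor g (Φ x) u v w z = 0 := by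
  obtain ⟨G, Γ, hG, hΓ, hR⟩ := exists_leviCivita_chart g (Φ x)
  set p := Φ x with hp
  set I := 𝓘(ℝ, EuclideanSpace ℝ (Fin k) × EuclideanSpace ℝ (Fin m))
  set θ : EuclideanSpace ℝ (Fin k) × EuclideanSpace ℝ (Fin m) → M := Φ ∘ productChartSymm x with hθ
  set ψ : EuclideanSpace ℝ (Fin k) × EuclideanSpace ℝ (Fin m) → EuclideanSpace ℝ (Fin n) :=
    extChartAt (𝓡 n) p ∘ θ with hψ
  set x₀ : EuclideanSpace ℝ (Fin k) × EuclideanSpace ℝ (Fin m) :=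
    (extChartAt (𝓡 k) x.1 x.1, extChartAt (𝓡 m) x.2 x.2) with hx₀
  have hχx : productChartSymm x x₀ = x := by
    simp [productChartSymm, hx₀]
  have hθx : θ x₀ = p := by simp only [hθ, Function.comp_apply, hχx, hp]
  have hψx : ψ x₀ = extChartAt (𝓡 n) p p := by simp only [hψ, Function.comp_apply, hθx]
  have hmem₁ : ∀ᶠ y in 𝓝 x₀, y.1 ∈ (extChartAt (𝓡 k) x.1).target :=
    continuousAt_fst.eventually ((isOpen_extChartAt_target x.1).mem_nhds
      (mem_extChartAt_target x.1))
  have hmem₂ : ∀ᶠ y in 𝓝 x₀, y.2 ∈ (extChartAt (𝓡 m) x.2).target :=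
    continuousAt_snd.eventually ((isOpen_extChartAt_target x.2).mem_nhds
      (mem_extChartAt_target x.2))
  have hθs : ∀ᶠ y in 𝓝 x₀, ContMDiffAt I (𝓡 n) ∞ θ y := by
    filter_upwards [hmem₁, hmem₂] with y h1 h2
    exact (hΦ.2.1.contMDiff.contMDiffAt).comp y (contMDiffAt_productChartSymm x h1 h2)
  have hsource : ∀ᶠ y in 𝓝 x₀, θ y ∈ (extChartAt (𝓡 n) p).source := by
    refine hθs.self_of_nhds.continuousAt.eventually ?_
    rw [hθx]
    exact extChartAt_source_mem_nhds p
  have hext : ContMDiffAt (𝓡 n) 𝓘(ℝ, EuclideanSpace ℝ (Fin n)) ∞ (extChartAt (𝓡 n) p) (θ x₀) := by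
    rw [hθx]; exact contMDiffAt_extChartAt
  have hψs : ContDiffAt ℝ 3 ψ x₀ :=
    (hext.comp x₀ hθs.self_of_nhds).contDiffAt.of_le ENat.LEInfty.out
  -- Near `x₀` the inverse chart composed with `ψ` is `θ`, so the chart metric pulled back by `ψ` is
  -- `g` pulled back by `θ`, the product metric.
  have hprod : ∀ᶠ y in 𝓝 x₀, ∀ a b, G (ψ y) (fderiv ℝ ψ y a) (fderiv ℝ ψ y b) =
      metricInChart g₁ x.1 y.1 a.1 b.1 + metricInChart g₂ x.2 y.2 a.2 b.2 := by
    filter_upwards [hmem₁, hmem₂, hθs, hsource.eventually_nhds,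
      (hψs.of_le (m := 1) (by norm_num)).eventually (by simp)] with y h1 h2 h3 h4 h5 a b
    have hψd : MDifferentiableAt I 𝓘(ℝ, EuclideanSpace ℝ (Fin n)) ψ y :=
      (h5.differentiableAt (by norm_num)).mdifferentiableAt
    have hsymm : MDifferentiableAt 𝓘(ℝ, EuclideanSpace ℝ (Fin n)) (𝓡 n)
        (extChartAt (𝓡 n) p).symm (ψ y) :=
      (contMDiffAt_extChartAt_symm_of_mem p
        ((extChartAt (𝓡 n) p).map_source h4.self_of_nhds)).mdifferentiableAt (by simp)
    have h6 : (extChartAt (𝓡 n) p).symm ∘ ψ =ᶠ[𝓝 y] θ := by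
      filter_upwards [h4] with t ht using (extChartAt (𝓡 n) p).left_inv ht
    have h7 := pullbackMetric_comp g hsymm hψd a b
    rw [mfderiv_eq_fderiv] at h7
    rw [hG, metricInChart_eq_pullbackMetric]
    exact (h7.symm.trans (pullbackMetric_congr g h6 a b)).trans
      (pullbackMetric_product hΦ x h1 h2 a b)
  have h₁zero : ∀ y v, metricInChart g₁ x.1 y 0 v = 0 := fun y v =>
    LinearMap.map_zero₂ (chartForm g₁ x.1 y) v
  have h₂zero : ∀ y v, metricInChart g₂ x.2 y 0 v = 0 := fun y v =>
    LinearMap.map_zero₂ (chartForm g₂ x.2 y) v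
  have h₁zero' : ∀ y v, metricInChart g₁ x.1 y v 0 = 0 := fun y v =>
    map_zero (chartForm g₁ x.1 y v)
  have h₂zero' : ∀ y v, metricInChart g₂ x.2 y v 0 = 0 := fun y v =>
    map_zero (chartForm g₂ x.2 y v)
  have hpos₁ : ∀ v, v ≠ 0 → 0 < metricInChart g₁ x.1 x₀.1 v v := fun v hv =>
    metricInChart_pos g₁ x.1 hmem₁.self_of_nhds hv
  have hpos₂ : ∀ v, v ≠ 0 → 0 < metricInChart g₂ x.2 x₀.2 v v := fun v hv =>
    metricInChart_pos g₂ x.2 hmem₂.self_of_nhds hv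
  have hnonneg₁ : ∀ v, 0 ≤ metricInChart g₁ x.1 x₀.1 v v := fun v => by
    by_cases hv : v = 0
    · rw [hv, h₁zero]
    · exact (hpos₁ v hv).le
  have hnonneg₂ : ∀ v, 0 ≤ metricInChart g₂ x.2 x₀.2 v v := fun v => by
    by_cases hv : v = 0
    · rw [hv, h₂zero]
    · exact (hpos₂ v hv).le
  -- The pulled back metric is positive definite, so the derivative has no kernel; equality of
  -- dimensions gives surjectivity.
  have hinj : Function.Injective (fderiv ℝ ψ x₀) := by
    refine (injective_iff_map_eq_zero _).2 fun a ha => ?_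
    have h1 := hprod.self_of_nhds a a
    rw [ha, map_zero] at h1
    have h2 : a.1 = 0 := by
      by_contra h
      linarith [hpos₁ _ h, hnonneg₂ a.2]
    have h3 : a.2 = 0 := by
      by_contra h
      linarith [hpos₂ _ h, hnonneg₁ a.1]
    exact Prod.ext h2 h3
  have hsurj : Function.Surjective (fderiv ℝ ψ x₀) :=
    (LinearMap.injective_iff_surjective_of_finrank_eq_finrank
      (f := (fderiv ℝ ψ x₀ :
      EuclideanSpace ℝ (Fin k) × EuclideanSpace ℝ (Fin m) →ₗ[ℝ] EuclideanSpace ℝ (Fin n)))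
      (by simp [hn])).1 hinj
  rw [← hψx] at hΓ
  have hmixed := fun u v w z => hΓ.curvature_product_mixed hψs hsurj h₁zero h₁zero' h₂zero h₂zero'
    (fun v hv => by
      by_contra h
      exact (hpos₂ v h).ne' hv) hprod u v w z
  let τ : TangentSpace (𝓡 n) p ≃ₗ[ℝ] EuclideanSpace ℝ (Fin n) :=
    LinearEquiv.ofBijective (show TangentSpace (𝓡 n) p →ₗ[ℝ] EuclideanSpace ℝ (Fin n) from
      (mfderiv (𝓡 n) 𝓘(ℝ, EuclideanSpace ℝ (Fin n)) (extChartAt (𝓡 n) p) p).toLinearMap)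
      (toCoord_bijective p)
  have hτ : ∀ u, τ u = toCoord p u := fun u => rfl
  obtain ⟨Λ, hΛ, hΛinj, hΛsurj⟩ :
      ∃ Λ : (EuclideanSpace ℝ (Fin k) × EuclideanSpace ℝ (Fin m)) →ₗ[ℝ] TangentSpace (𝓡 n) p,
        (∀ a, toCoord p (Λ a) = fderiv ℝ ψ x₀ a) ∧ Function.Injective Λ ∧ Function.Surjective Λ :=
    ⟨τ.symm.toLinearMap ∘ₗ (fderiv ℝ ψ x₀ : _ →ₗ[ℝ] EuclideanSpace ℝ (Fin n)),
      fun a => by rw [← hτ]; exact τ.apply_symm_apply _, τ.symm.injective.comp hinj,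
      τ.symm.surjective.comp hsurj⟩
  have hinl : Function.Injective
      (Λ ∘ₗ LinearMap.inl ℝ (EuclideanSpace ℝ (Fin k)) (EuclideanSpace ℝ (Fin m))) :=
    hΛinj.comp LinearMap.inl_injective
  have hinr : Function.Injective
      (Λ ∘ₗ LinearMap.inr ℝ (EuclideanSpace ℝ (Fin k)) (EuclideanSpace ℝ (Fin m))) :=
    hΛinj.comp LinearMap.inr_injective
  refine ⟨LinearMap.range (Λ ∘ₗ LinearMap.inl ℝ _ _), LinearMap.range (Λ ∘ₗ LinearMap.inr ℝ _ _),
    ?_, ?_, ?_, ?_, ?_⟩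
  · refine eq_top_iff.2 fun v _ => ?_
    obtain ⟨⟨a, b⟩, rfl⟩ := hΛsurj v
    refine Submodule.mem_sup.2 ⟨_, ⟨a, rfl⟩, _, ⟨b, rfl⟩, ?_⟩
    simp [← map_add]
  · exact (LinearMap.finrank_range_of_inj hinl).trans (by simp)
  · exact (LinearMap.finrank_range_of_inj hinr).trans (by simp)
  · rintro _ ⟨a, rfl⟩ _ ⟨b, rfl⟩
    rw [← metricInChart_toCoord, ← hG, LinearMap.comp_apply, LinearMap.comp_apply, hΛ, hΛ, ← hψx,
      hprod.self_of_nhds]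
    simp [h₁zero', h₂zero]
  · rintro u v _ ⟨w, rfl⟩ _ ⟨z, rfl⟩
    obtain ⟨a, rfl⟩ := hΛsurj u
    obtain ⟨b, rfl⟩ := hΛsurj v
    rw [hR, LinearMap.comp_apply, LinearMap.comp_apply, hΛ, hΛ, hΛ, hΛ, ← hψx]
    exact hmixed a b w z

end Product

/-! ### Change of sign and passage to flatness near a point -/

lemma secondKind_neg {n : ℕ} {V : Type*} [AddCommGroup V] [Module ℝ V] (R : V → V → V → V → ℝ)
    (e : Fin n → V) (φ ψ : LinearMap.BilinForm ℝ V) :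
    secondKind (fun u v w z => -R u v w z) e φ ψ = -secondKind R e φ ψ := by
  simp [secondKind]

lemma fracSum_neg {N : ℕ} (α : ℝ) (a : Fin N → ℝ) :
    fracSum α (fun i => -a i) = -fracSum α a := by
  simp only [fracSum, mul_neg, Finset.sum_neg_distrib]

/-- The range of `Φ` is an open neighbourhood of `q`, and the tangent space splits at each of its
points, so the pointwise algebraic result applies throughout it, to the curvature tensor or to its
negative. -/
lemma isFlatAt_of_locallySplitsOff {n k : ℕ}
    {M : Type u} [TopologicalSpace M]
    [ChartedSpace (EuclideanSpace ℝ (Fin n)) M] [IsManifold (𝓡 n) ∞ M]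
    (g : SmoothMetric n M) (hk1 : 1 ≤ k) (hk2 : k < n) {α : ℝ} (hα1 : 1 ≤ α)
    (hα : α < k * ((n : ℝ) - k) + 2 * k * ((n : ℝ) - k) / n)
    (hR : AlphaNonneg g α ∨ AlphaNonpos g α) {q : M} (hq : LocallySplitsOff.{u, v, w} g k q) :
    ∀ᶠ p in 𝓝 q, IsFlatAt g p := by
  obtain ⟨M₁, _, _, _, M₂, _, _, _, g₁, g₂, Φ, hΦ, hqΦ⟩ := hq
  have hn : k + (n - k) = n := by omega
  filter_upwards [hΦ.2.1.isOpen_range.mem_nhds hqΦ]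
  rintro _ ⟨x, rfl⟩
  obtain ⟨W₁, W₂, hsup, h1, h2, horth, hmix⟩ := exists_curvature_splitting hn hΦ x
  set p := Φ x
  let γ : LinearMap.BilinForm ℝ (TangentSpace (𝓡 n) p) :=
    LinearMap.mk₂ ℝ (fun u v => g.inner p u v) (by simp) (by simp) (by simp) (by simp)
  have hcast : ((n - k : ℕ) : ℝ) = (n : ℝ) - k := Nat.cast_sub hk2.le
  have hα' : α < (k : ℝ) * (n - k : ℕ) + 2 * k * (n - k : ℕ) / ((k : ℝ) + (n - k : ℕ)) := by
    rw [hcast, add_sub_cancel]; exact hα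
  have : FiniteDimensional ℝ (TangentSpace (𝓡 n) p) :=
    inferInstanceAs (FiniteDimensional ℝ (EuclideanSpace ℝ (Fin n)))
  have hfin : Module.finrank ℝ (TangentSpace (𝓡 n) p) = n :=
    finrank_euclideanSpace_fin (𝕜 := ℝ) (n := n)
  have hcurv := isCurvatureLike_riemannTensor g p
  rcases hR with hR | hR
  · exact curvature_eq_zero_of_split hn hfin hk1 (by omega) hα1 hα' γ (g.symm p) (g.pos p) hcurv
      (fun e he φ hφ => hR p e he φ hφ) hsup h1 h2 horth hmix
  · intro u v w z
    have h := curvature_eq_zero_of_split hn hfin hk1 (by omega) hα1 hα' γ (g.symm p) (g.pos p)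
      hcurv.neg (fun e he φ hφ => by
        simp only [secondKind_neg, fracSum_neg]
        linarith [hR p e he φ hφ]) hsup h1 h2 horth
      (fun u v w hw z hz => by rw [hmix u v w hw z hz, neg_zero]) u v w z
    exact neg_eq_zero.1 h

end

/-- Let `(M, g)` be an `n`-dimensional Riemannian manifold with `α`-nonnegative or `α`-nonpositive
curvature operator of the second kind for some `α < k(n-k) + 2k(n-k)/n`, where `1 ≤ k ≤ n/2`. Near
every point at which it locally splits off a `k`-dimensional factor, `M` is flat; and if it does so
at every point, then `M` is flat. -/
theorem theorem1p6 {n : ℕ}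
    {M : Type u} [TopologicalSpace M] [T2Space M] [SecondCountableTopology M]
    [ChartedSpace (EuclideanSpace ℝ (Fin n)) M] [IsManifold (𝓡 n) ∞ M]
    (g : SmoothMetric n M) (k : ℕ) (hk1 : 1 ≤ k) (hk2 : (k : ℝ) ≤ n / 2)
    (α : ℝ) (hα1 : 1 ≤ α)
    (hα : α < k * ((n : ℝ) - k) + 2 * k * ((n : ℝ) - k) / n)
    (hR : AlphaNonneg g α ∨ AlphaNonpos g α) :
    (∀ q : M, LocallySplitsOff.{u, v, w} g k q → ∀ᶠ p in 𝓝 q, IsFlatAt g p) ∧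
      ((∀ q : M, LocallySplitsOff.{u, v, w} g k q) → IsFlat g) := by
  have hkn : k < n := by
    have h1 : (1 : ℝ) ≤ k := by exact_mod_cast hk1
    have h2 : (k : ℝ) < n := by linarith
    exact_mod_cast h2
  have h : ∀ q : M, LocallySplitsOff.{u, v, w} g k q → ∀ᶠ p in 𝓝 q, IsFlatAt g p :=
    fun q hq => isFlatAt_of_locallySplitsOff g hk1 hkn hα1 hα hR hq
  exact ⟨h, fun hsplit p => (h p (hsplit p)).self_of_nhds⟩
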